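/- **Model.** Fix $\alpha\in[0,1)$, integers $1\le B\le N_S$, and reals $S_A>0$, $c_{TX}>0$, $\phi\ge 0$, $\epsilon>0$. A fusion center (FC) tracks a scalar Gauss–Markov process $X_{k+1}=\sqrt{\alpha}X_k+Z_k$ of stationary variance $1$ with the help of $N_S$ sensor nodes (SNs) sharing $B$ orthogonal collision channels. The accuracy states $\gamma_{n,k}$ of the SNs take values in a finite set $\Gamma\subset\mathbb R$ with $\max\Gamma=1$, and evolve independently across $n$ as Markov chains with common transition law $P_\gamma$ and steady-state (invariant) distribution $\pi_\gamma$, $\pi_\gamma(1)>0$. Either $\gamma_{n,k}$ converges in law to $\pi_\gamma$ from every initial state (the law of $\boldsymbol\gamma_0=(\gamma_{1,0},\dots,\gamma_{N_S,0})$ being then arbitrary), or $\boldsymbol\gamma_0$ is in steady state, i.e. has law $\pi_\gamma^{\otimes N_S}$. In slot $k\ge 0$, SN $n$ is idle ($A_{n,k}=0$) or active ($A_{n,k}=1$), and in the latter case chooses a measurement SNR $S_{M,n,k}\in[0,\infty)$ and a channel in $\{1,\dots,B\}$. Its cost is $c_{SN}(A_{n,k},S_{M,n,k})=A_{n,k}(c_{TX}+\phi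 S_{M,n,k})$, and its packet is received ($O_{n,k}=1$) iff it is the only active SN on its channel. The aggregate SNR is $$\Lambda_k=\sum_{n=1}^{N_S}O_{n,k}\,\gamma_{n,k}^2\,\frac{S_AS_{M,n,k}}{S_A+S_{M,n,k}} .$$ The Kalman variances are $V_0=1$, $\hat V_k=V_k/(1+V_k\Lambda_k)$, $V_{k+1}=1-\alpha(1-\hat V_k)$, where $\hat V_k$ is the MSE in slot $k$. An instruction policy $\delta$ draws in each slot $k$ an instruction $\mathbf D_k\sim\delta_k(\cdot\mid V_k,\pi_{\boldsymbol\gamma,k})$, where $\pi_{\boldsymbol\gamma,k}$ is the FC's belief on $\boldsymbol\gamma_k=(\gamma_{1,k},\dots,\gamma_{N_S,k})$. In the *coordinated* scheme the FC knows $\boldsymbol\gamma_k$ and $\mathbf D_k$ lists the actions of all SNs. In the *decentralized* scheme $\mathbf D_k=(q_k,S_{M,k})$ with $q_k:\Gamma\to[0,1]$, $S_{M,k}:\Gamma\to[0,\infty)$; SN $n$ activates, independently of the others, with probability $q_k(\gamma_{n,k})$, uses $S_{M,k}(\gamma_{n,k})$ and picks a channel uniformly at random; the FC sees on each channel nothing,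 a collision, or a packet that reveals its sender and the sender's accuracy state, and updates $\pi_{\boldsymbol\gamma,k}$ by Bayes' rule. Put $\bar M_\delta=\liminf_{T\to\infty}\mathbb E_\delta\big[\frac1{T+1}\sum_{k=0}^T\hat V_k\big]$. A policy $\delta$ is *feasible* if $\limsup_{T\to\infty}\mathbb E_\delta\big[\frac1{T+1}\sum_{k=0}^T c_{SN}(A_{n,k},S_{M,n,k})\big]\le\epsilon/N_S$ for every $n$. For each scheme let $$\bar\Lambda^*=\sup_{\delta\text{ feasible}}\ \limsup_{T\to\infty}\frac1{T+1}\sum_{k=0}^T\mathbb E_\delta[\Lambda_k],$$ and let $\bar\Lambda^*_{\rm slot}$ be the single-slot steady-state value: the supremum of $\mathbb E[\Lambda]$ subject to $\mathbb E[c_{SN}(A_n,S_{M,n})]\le\epsilon/N_S$ for all $n$, where $\boldsymbol\gamma\sim\pi_\gamma^{\otimes N_S}$ and the random instruction depends on $\boldsymbol\gamma$ (coordinated scheme), respectively is independent of $\boldsymbol\gamma$ (decentralized scheme). Let $$\hat\nu^*(x)=\frac{\sqrt{(1-\alpha)^2(1+x^2)+2(1-\alpha^2)x}-(1-\alpha)(1+x)}{2\alpha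 x},$$ extended by continuity to $\hat\nu^*(0)=1$, and to $\hat\nu^*(x)=1/(1+x)$ if $\alpha=0$. **Theorem (MSE lower bound, infinite horizon).** In either scheme, every feasible policy $\delta$ (in particular an optimal one) satisfies $\bar M_\delta\ge\hat\nu^*(\bar\Lambda^*)$. Moreover $\bar M_\delta\ge\hat\nu^*(\bar\Lambda^*_{\rm slot})$ in the coordinated scheme, and in the decentralized scheme whenever the accuracy states are i.i.d. over time ($P_\gamma(\gamma;\cdot)=\pi_\gamma$ for all $\gamma\in\Gamma$; this includes the case in which all accuracy states equal $1$). -/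

import Mathlib

open MeasureTheory ProbabilityTheory Filter Topology
open scoped NNReal ENNReal

noncomputable section

namespace SensorNet

/-! ### Kalman variance recursion -/

/-- Prior variance of the next sample, given the posterior variance of the current one. -/
def nu (α v : ℝ) : ℝ := 1 - α * (1 - v)

/-- Posterior variance, given the prior variance `V` and the aggregate SNR `L`. -/
def hatNu (V L : ℝ) : ℝ := V / (1 + V * L)

/-- Posterior variance at the end of slot `k`, started from the prior variance `V₀` in slot `0`. -/
def hatNuSeq (α V₀ : ℝ) (L : ℕ → ℝ) : ℕ → ℝ
  | 0 => hatNu V₀ (L 0)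
  | k + 1 => hatNu (nu α (hatNuSeq α V₀ L k)) (L (k + 1))

/-- Sample average MSE over the slots `0, …, T`. -/
def sampleMSE (α V₀ : ℝ) (L : ℕ → ℝ) (T : ℕ) : ℝ :=
  (1 / ((T : ℝ) + 1)) * ∑ k ∈ Finset.range (T + 1), hatNuSeq α V₀ L k

/-- The function `ν̂*`. The explicit formula reads `0 / 0` when `α = 0` or `x = 0`; there we take its
continuous extension. -/
def nuStar (α x : ℝ) : ℝ :=
  if α = 0 then 1 / (1 + x)
  else if x = 0 then 1
  else (Real.sqrt ((1 - α) ^ 2 * (1 + x ^ 2) + 2 * (1 - α ^ 2) * x) - (1 - α) * (1 + x))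
    / (2 * α * x)

/-! ### The network -/

/-- Parameters of the network: the time-correlation `α`, the number `N` of sensor nodes (SNs), the
number `B` of channels, the ambient SNR `SA`, the transmission cost `cTX`, the unitary sensing cost
`φ`, the cost budget `ε` of the network, the finite set `Γ` of accuracy states, whose maximum is `1`,
the transition law `trans` of the accuracy state of an SN and its steady-state law `steady`. -/
structure Model where
  α : ℝ
  α_nonneg : 0 ≤ α
  α_lt_one : α < 1
  N : ℕ
  B : ℕ
  one_le_B : 1 ≤ B
  B_le_N : B ≤ N
  SA : ℝ
  SA_pos : 0 < SA
  cTX : ℝ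
  cTX_pos : 0 < cTX
  φ : ℝ
  φ_nonneg : 0 ≤ φ
  ε : ℝ
  ε_pos : 0 < ε
  Γ : Finset ℝ
  one_mem : (1 : ℝ) ∈ Γ
  le_one : ∀ g ∈ Γ, g ≤ 1
  trans : Γ → PMF Γ
  steady : PMF Γ
  steady_invariant : steady.bind trans = steady
  steady_one_pos : 0 < steady ⟨1, one_mem⟩

namespace Model

variable (M : Model)

/-- Vector of the accuracy states of all SNs. -/
abbrev State : Type := Fin M.N → M.Γ

/-- Sensing-transmission actions `(A, S_M, B)` of all SNs. When `A = false` (idle) the other two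
entries are immaterial: nothing below depends on them. -/
abbrev Action : Type := Fin M.N → Bool × ℝ≥0 × Fin M.B

/-- The activations and channel indices of all SNs. -/
abbrev Access : Type := Fin M.N → Bool × Fin M.B

/-- A belief of the fusion center (FC) on the accuracy-state vector (a probability mass function). -/
abbrev Belief : Type := M.State → ℝ

variable {M}

/-- The activations and channel indices in an action. -/
def access (x : M.Action) : M.Access := fun n => ((x n).1, (x n).2.2)

/-- Collision channel: the packet of SN `n` is received iff `n` is active and no other active SN uses
the same channel. -/
def Delivered (a : M.Access) (n : Fin M.N) : Prop :=
  (a n).1 = true ∧ ∀ m, m ≠ n → (a m).1 = true → (a m).2 ≠ (a n).2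

variable (M) in
/-- Local SNR of an SN with accuracy state `g` and local measurement SNR `s`. -/
def localSNR (g : ℝ) (s : ℝ≥0) : ℝ := g ^ 2 * (M.SA * s / (M.SA + s))

open Classical in
/-- Aggregate SNR collected at the FC. -/
def aggSNR (x : M.Action) (g : M.State) : ℝ :=
  ∑ n, if Delivered (access x) n then M.localSNR (g n : ℝ) (x n).2.1 else 0

/-- Sensing-transmission cost of SN `n`. -/
def cost (x : M.Action) (n : Fin M.N) : ℝ :=
  if (x n).1 = true then M.cTX + M.φ * ((x n).2.1 : ℝ) else 0

/-- What the FC sees on one channel: nothing, a collision, or a packet, which carries the identity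
and the accuracy state of its sender. -/
inductive ChannelOutcome (S G : Type) : Type
  | idle : ChannelOutcome S G
  | collision : ChannelOutcome S G
  | success (sender : S) (acc : G) : ChannelOutcome S G

open Classical in
/-- What the FC sees on each channel. -/
def outcome (a : M.Access) (g : M.State) : Fin M.B → ChannelOutcome (Fin M.N) M.Γ := fun c =>
  if h : ∃ n, Delivered a n ∧ (a n).2 = c then .success h.choose (g h.choose)
  else if ∃ n, (a n).1 = true ∧ (a n).2 = c then .collision
  else .idle

variable (M) in
/-- Transition kernel of the accuracy-state vector: the SNs move independently. -/
def stateKernel : Kernel M.State M.State :=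
  Kernel.ofFunOfCountable fun g => Measure.pi fun n => (M.trans (g n)).toMeasure

instance : IsMarkovKernel M.stateKernel :=
  ⟨fun g => by
    change IsProbabilityMeasure (Measure.pi fun n => (M.trans (g n)).toMeasure)
    infer_instance⟩

/-! ### Schemes -/

/-- A scheme: the instructions that the FC may broadcast, the law of the actions of the SNs given the
instruction and the accuracy states, and the belief of the FC on the accuracy-state vector at the
beginning of a slot, given the belief `β` predicted from its past observations and the actual accuracy
states. Only the two schemes `coordinated` and `decentralized` below are used. -/
structure Scheme (M : Model) where
  Instr : Type
  [measurableSpaceInstr : MeasurableSpace Instr]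
  act : Kernel (Instr × M.State) M.Action
  [isMarkovKernel_act : IsMarkovKernel act]
  belief : M.Belief → M.State → M.Belief
  measurable_belief : Measurable fun p : M.Belief × M.State => belief p.1 p.2

attribute [instance] Scheme.measurableSpaceInstr Scheme.isMarkovKernel_act

variable (M) in
open Classical in
/-- Coordinated scheme: the instruction is the vector of the actions of all SNs, and the FC knows the
accuracy states. -/
def coordinated : Scheme M where
  Instr := M.Action
  act := Kernel.deterministic Prod.fst measurable_fst
  belief := fun _ g => fun g' => if g' = g then 1 else 0
  measurable_belief :=
    (measurable_of_countable fun (g : M.State) => (fun g' => if g' = g then (1 : ℝ) else 0)).comp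
      measurable_snd

/-- Probability that an SN makes the access choice `t` (activity, channel) when it activates with
probability `q`; its channel is uniform. -/
def choiceProb (B : ℕ) (q : ℝ) (t : Bool × Fin B) : ℝ :=
  (if t.1 = true then q else 1 - q) / B

lemma sum_choiceProb {B : ℕ} (hB : 1 ≤ B) (q : ℝ) : ∑ t, choiceProb B q t = 1 := by
  have hB' : (B : ℝ) ≠ 0 := by
    have : B ≠ 0 := by omega
    exact_mod_cast this
  rw [Fintype.sum_prod_type]
  simp only [choiceProb, Fintype.sum_bool, Finset.sum_const, Finset.card_univ, Fintype.card_fin,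
    nsmul_eq_mul]
  simp
  field_simp
  ring

variable (M) in
/-- Instructions of the decentralized scheme: activation probabilities `q(·)` and local measurement
SNRs `S_M(·)`, as functions of the local accuracy state. -/
abbrev DecInstr : Type := (M.Γ → unitInterval) × (M.Γ → ℝ≥0)

variable (M) in
/-- In the decentralized scheme each SN independently activates with probability `q(γₙ)`, uses the
local measurement SNR `S_M(γₙ)`, and picks a channel uniformly at random. -/
def decAct : Kernel (M.DecInstr × M.State) M.Action where
  toFun p := ∑ t : M.Access,
    ENNReal.ofReal (∏ n, choiceProb M.B (p.1.1 (p.2 n) : ℝ) (t n)) •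
      Measure.dirac (fun n => ((t n).1, p.1.2 (p.2 n), (t n).2))
  measurable' := by
    apply measurable_from_prod_countable_left
    intro g
    refine Measure.measurable_of_measurable_coe _ fun s hs => ?_
    simp only [Measure.coe_finsetSum, Finset.sum_apply, Measure.smul_apply, smul_eq_mul]
    refine Finset.measurable_sum _ fun t _ => Measurable.mul ?_ ?_
    · refine ENNReal.measurable_ofReal.comp (Finset.measurable_prod _ fun n _ => ?_)
      unfold choiceProb
      split_ifs <;> fun_prop
    · refine (Measure.measurable_coe hs).comp (Measure.measurable_dirac.comp ?_)
      fun_prop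

instance : IsMarkovKernel M.decAct := by
  refine ⟨fun p => ⟨?_⟩⟩
  change (∑ t : M.Access, ENNReal.ofReal (∏ n, choiceProb M.B (p.1.1 (p.2 n) : ℝ) (t n)) •
      Measure.dirac (fun n => ((t n).1, p.1.2 (p.2 n), (t n).2)) : Measure M.Action) Set.univ = 1
  have h0 : ∀ n (t : Bool × Fin M.B), 0 ≤ choiceProb M.B (p.1.1 (p.2 n) : ℝ) t := by
    intro n t
    have h1 := (p.1.1 (p.2 n)).2.1
    have h2 := (p.1.1 (p.2 n)).2.2
    unfold choiceProb
    split_ifs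
    · positivity
    · exact div_nonneg (by linarith) (by positivity)
  simp only [Measure.coe_finsetSum, Finset.sum_apply, Measure.smul_apply, smul_eq_mul,
    measure_univ, mul_one]
  rw [← ENNReal.ofReal_sum_of_nonneg (fun t _ => Finset.prod_nonneg fun n _ => h0 n _)]
  have h := Finset.prod_univ_sum (fun _ : Fin M.N => (Finset.univ : Finset (Bool × Fin M.B)))
    (fun n t => choiceProb M.B (p.1.1 (p.2 n) : ℝ) t)
  simp only [sum_choiceProb M.one_le_B, Finset.prod_const_one, Fintype.piFinset_univ] at h
  rw [← h, ENNReal.ofReal_one]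

variable (M) in
/-- Decentralized scheme: the FC only has the belief predicted from its observations. -/
def decentralized : Scheme M where
  Instr := M.DecInstr
  act := M.decAct
  belief := fun β _ => β
  measurable_belief := measurable_fst

/-! ### Belief update -/

/-- One-step prediction of the belief. -/
def predict (β : M.Belief) : M.Belief := fun g' =>
  ∑ g, β g * ∏ n, (M.trans (g n) (g' n)).toReal

namespace Scheme

variable (s : Scheme M)

/-- Likelihood of the channel outcomes `o`, given the instruction `d` and the accuracy states `g`. -/
def likelihood (d : s.Instr) (o : Fin M.B → ChannelOutcome (Fin M.N) M.Γ) (g : M.State) : ℝ :=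
  (s.act (d, g)).real {x | outcome (access x) g = o}

open Classical in
/-- Bayes' rule for the belief (left unchanged on the null event of an outcome that has probability
zero). -/
def posterior (β : M.Belief) (d : s.Instr) (o : Fin M.B → ChannelOutcome (Fin M.N) M.Γ) :
    M.Belief := fun g =>
  if ∑ g', β g' * s.likelihood d o g' = 0 then β g
  else β g * s.likelihood d o g / ∑ g', β g' * s.likelihood d o g'

end Scheme

/-! ### Measurability -/

lemma measurable_access : Measurable (access : M.Action → M.Access) := by
  unfold access
  fun_prop

lemma measurable_aggSNR : Measurable fun p : M.Action × M.State => aggSNR p.1 p.2 := by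
  classical
  unfold aggSNR
  refine Finset.measurable_sum _ fun n _ => Measurable.ite ?_ ?_ measurable_const
  · exact (measurable_access.comp measurable_fst)
      (Set.Finite.measurableSet (Set.toFinite {a : M.Access | Delivered a n}))
  · unfold localSNR
    have h : Measurable fun p : M.Action × M.State => ((p.2 n : M.Γ) : ℝ) :=
      measurable_subtype_coe.comp ((measurable_pi_apply n).comp measurable_snd)
    have h' : Measurable fun p : M.Action × M.State => (((p.1 n).2.1 : ℝ≥0) : ℝ) :=
      by fun_prop
    exact (h.pow_const 2).mul ((h'.const_mul _).div (h'.const_add _))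

lemma measurable_predict : Measurable (predict : M.Belief → M.Belief) := by
  unfold predict
  fun_prop

namespace Scheme

variable (s : Scheme M)

lemma measurable_likelihood (o : Fin M.B → ChannelOutcome (Fin M.N) M.Γ) (g : M.State) :
    Measurable fun d => s.likelihood d o g := by
  have hs : MeasurableSet {x : M.Action | outcome (access x) g = o} :=
    measurable_access (Set.Finite.measurableSet (Set.toFinite {a : M.Access | outcome a g = o}))
  exact ((s.act.measurable_coe hs).comp (measurable_id.prodMk measurable_const)).ennreal_toReal

lemma measurable_posterior (o : Fin M.B → ChannelOutcome (Fin M.N) M.Γ) :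
    Measurable fun p : M.Belief × s.Instr => s.posterior p.1 p.2 o := by
  classical
  have hl : ∀ g, Measurable fun p : M.Belief × s.Instr => p.1 g * s.likelihood p.2 o g := fun g =>
    ((measurable_pi_apply g).comp measurable_fst).mul
      ((s.measurable_likelihood o g).comp measurable_snd)
  have hz : Measurable fun p : M.Belief × s.Instr => ∑ g', p.1 g' * s.likelihood p.2 o g' :=
    Finset.measurable_sum _ fun g _ => hl g
  refine measurable_pi_lambda _ fun g => ?_
  unfold posterior
  exact Measurable.ite (hz (measurableSet_singleton 0))
    ((measurable_pi_apply g).comp measurable_fst) ((hl g).div hz)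

/-! ### The controlled process -/

/-- What happens in one slot: the prior variance, the belief of the FC and the accuracy states at its
beginning, then the instruction and the actions of the SNs. -/
abbrev Slot : Type := (ℝ × M.Belief × M.State) × (s.Instr × M.Action)

/-- Prior variance, belief and accuracy states at the beginning of the slot that follows the slot `z`,
if the accuracy states move to `g'`. -/
def next (p : s.Slot × M.State) : ℝ × M.Belief × M.State :=
  match p with
  | (((V, β, g), (d, x)), g') =>
    (nu M.α (hatNu V (aggSNR x g)),
      s.belief (predict (s.posterior β d (outcome (access x) g))) g', g')

lemma measurable_next : Measurable s.next := by
  have hL : Measurable fun p : s.Slot × M.State => aggSNR p.1.2.2 p.1.1.2.2 :=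
    measurable_aggSNR.comp (by fun_prop : Measurable fun p : s.Slot × M.State =>
      (p.1.2.2, p.1.1.2.2))
  have h1 : Measurable fun p : s.Slot × M.State =>
      nu M.α (hatNu p.1.1.1 (aggSNR p.1.2.2 p.1.1.2.2)) := by
    unfold nu hatNu
    fun_prop
  have hq : Measurable fun q : (M.Belief × s.Instr) × (M.Access × M.State) =>
      s.posterior q.1.1 q.1.2 (outcome q.2.1 q.2.2) := by
    refine measurable_from_prod_countable_left fun r => ?_
    exact s.measurable_posterior (outcome r.1 r.2)
  have h2 : Measurable fun p : s.Slot × M.State =>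
      s.posterior p.1.1.2.1 p.1.2.1 (outcome (access p.1.2.2) p.1.1.2.2) := by
    refine hq.comp (g := fun q : (M.Belief × s.Instr) × (M.Access × M.State) =>
      s.posterior q.1.1 q.1.2 (outcome q.2.1 q.2.2))
      (f := fun p : s.Slot × M.State =>
        ((p.1.1.2.1, p.1.2.1), (access p.1.2.2, p.1.1.2.2))) ?_
    have := (measurable_access (M := M)).comp
      (by fun_prop : Measurable fun p : s.Slot × M.State => p.1.2.2)
    exact Measurable.prodMk (by fun_prop) (this.prodMk (by fun_prop))
  have h3 : Measurable fun p : s.Slot × M.State =>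
      s.belief (predict (s.posterior p.1.1.2.1 p.1.2.1
        (outcome (access p.1.2.2) p.1.1.2.2))) p.2 :=
    s.measurable_belief.comp ((measurable_predict.comp h2).prodMk measurable_snd)
  exact h1.prodMk (h3.prodMk measurable_snd)

/-- An instruction policy: in slot `k`, the instruction is drawn from a law that depends on the prior
variance and on the belief on the accuracy states (and on `k`). -/
structure Policy where
  draw : ℕ → Kernel (ℝ × M.Belief) s.Instr
  [isMarkovKernel_draw : ∀ k, IsMarkovKernel (draw k)]

attribute [instance] Policy.isMarkovKernel_draw

variable {s}

/-- Law of the instruction and of the actions in slot `k`, given the prior variance, the belief and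
the accuracy states. -/
def Policy.decide (δ : s.Policy) (k : ℕ) :
    Kernel (ℝ × M.Belief × M.State) (s.Instr × M.Action) :=
  ((δ.draw k).comap (fun z => (z.1, z.2.1)) (by fun_prop)) ⊗ₖ
    (s.act.comap (fun w : (ℝ × M.Belief × M.State) × s.Instr => (w.2, w.1.2.2)) (by fun_prop))

instance (δ : s.Policy) (k : ℕ) : IsMarkovKernel (δ.decide k) := by
  unfold Policy.decide
  infer_instance

variable (s) in
/-- Law of the prior variance, belief and accuracy states of the next slot, given the current slot. -/
def advance : Kernel s.Slot (ℝ × M.Belief × M.State) :=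
  (Kernel.id ×ₖ (M.stateKernel.comap (fun z : s.Slot => z.1.2.2) (by fun_prop))).map s.next

instance : IsMarkovKernel s.advance := by
  unfold advance
  exact Kernel.IsMarkovKernel.map _ s.measurable_next

/-- Law of slot `k + 1`, given slot `k`. -/
def Policy.step (δ : s.Policy) (k : ℕ) : Kernel s.Slot s.Slot :=
  s.advance ⊗ₖ (Kernel.prodMkLeft s.Slot (δ.decide (k + 1)))

instance (δ : s.Policy) (k : ℕ) : IsMarkovKernel (δ.step k) := by
  unfold Policy.step
  infer_instance

variable (s) in
/-- Law of the belief and the accuracy states when the latter are drawn from `p` and the FC has no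
other information. -/
def startLaw (p : PMF M.State) : Measure (M.Belief × M.State) :=
  p.toMeasure.map fun g => (s.belief (fun g' => (p g').toReal) g, g)

/-- Law of slot `0`, from the prior variance `1` and the initial law `p₀` of the accuracy states. -/
def Policy.initial (δ : s.Policy) (p₀ : PMF M.State) : Measure s.Slot :=
  ((Measure.dirac (1 : ℝ)).prod (s.startLaw p₀)) ⊗ₘ (δ.decide 0)

/-- Law of the whole process induced by the policy `δ`, on the space of slot sequences. -/
def Policy.law (δ : s.Policy) (p₀ : PMF M.State) : Measure (ℕ → s.Slot) :=
  Kernel.trajMeasure (X := fun _ => s.Slot) (δ.initial p₀)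
    (fun k => (δ.step k).comap (fun h : (i : Finset.Iic k) → s.Slot => h ⟨k, by simp⟩) (by fun_prop))

/-! ### Performance metrics -/

variable (s) in
/-- Aggregate SNR sequence along a realization of the process. -/
def snr (ω : ℕ → s.Slot) (k : ℕ) : ℝ := aggSNR (ω k).2.2 (ω k).1.2.2

/-- Average MSE over the slots `0, …, T`, with `V₀ = 1`. -/
def Policy.mse (δ : s.Policy) (p₀ : PMF M.State) (T : ℕ) : ℝ :=
  ∫ ω, sampleMSE M.α 1 (s.snr ω) T ∂(δ.law p₀)

/-- Average aggregate SNR over the slots `0, …, T`. -/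
def Policy.avgSNR (δ : s.Policy) (p₀ : PMF M.State) (T : ℕ) : ℝ :=
  (1 / ((T : ℝ) + 1)) * ∑ k ∈ Finset.range (T + 1), ∫ ω, s.snr ω k ∂(δ.law p₀)

/-- Average sensing-transmission cost of SN `n` over the slots `0, …, T` (possibly infinite). -/
def Policy.avgCost (δ : s.Policy) (p₀ : PMF M.State) (n : Fin M.N) (T : ℕ) : ℝ≥0∞ :=
  ∫⁻ ω, ENNReal.ofReal
    ((1 / ((T : ℝ) + 1)) * ∑ k ∈ Finset.range (T + 1), cost (ω k).2.2 n) ∂(δ.law p₀)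

/-- The infinite-horizon cost constraint: the long-term average cost of each SN is at most `ε / N`. -/
def Policy.Feasible (δ : s.Policy) (p₀ : PMF M.State) : Prop :=
  ∀ n, limsup (δ.avgCost p₀ n) atTop ≤ ENNReal.ofReal (M.ε / M.N)

/-- Infinite-horizon average MSE. -/
def Policy.longRunMSE (δ : s.Policy) (p₀ : PMF M.State) : ℝ := liminf (δ.mse p₀) atTop

/-- Infinite-horizon average of the expected aggregate SNR. -/
def Policy.longRunSNR (δ : s.Policy) (p₀ : PMF M.State) : ℝ := limsup (δ.avgSNR p₀) atTop

variable (s) in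
/-- Maximal long-term expected aggregate SNR under the cost constraint. -/
def maxSNR (p₀ : PMF M.State) : ℝ :=
  sSup {x | ∃ δ : s.Policy, δ.Feasible p₀ ∧ x = δ.longRunSNR p₀}

/-! ### The single-slot problem in steady state -/

variable (s) in
/-- Law of accuracy states, instruction and actions in a single slot, when the accuracy states are
drawn from `p` and the instruction is drawn from `δ` given the belief of the FC. -/
def slotLaw (p : PMF M.State) (δ : Kernel M.Belief s.Instr) :
    Measure ((M.Belief × M.State) × (s.Instr × M.Action)) :=
  (s.startLaw p) ⊗ₘ ((δ.comap (fun z => z.1) (by fun_prop)) ⊗ₖ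
    (s.act.comap (fun w : (M.Belief × M.State) × s.Instr => (w.2, w.1.2)) (by fun_prop)))

variable (s) in
/-- Maximal expected aggregate SNR in a single slot, subject to the cost constraint in that slot, when
the accuracy states have law `p`. -/
def slotMaxSNR (p : PMF M.State) : ℝ :=
  sSup {x | ∃ δ : Kernel M.Belief s.Instr, IsMarkovKernel δ ∧
    (∀ n, ∫⁻ z, ENNReal.ofReal (cost z.2.2 n) ∂(s.slotLaw p δ) ≤ ENNReal.ofReal (M.ε / M.N)) ∧
    x = ∫ z, aggSNR z.2.2 z.1.2 ∂(s.slotLaw p δ)}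

end Scheme

variable (M) in
/-- Steady-state law of the accuracy-state vector: independent SNs, each with law `steady`. -/
def IsSteady (p : PMF M.State) : Prop :=
  ∀ g, p g = ∏ n, M.steady (g n)

variable (M) in
/-- The accuracy state of an SN converges in law to its steady state from every initial state. -/
def Ergodic : Prop :=
  ∀ g g' : M.Γ, Tendsto (fun k : ℕ => ((fun p : PMF M.Γ => p.bind M.trans)^[k] (PMF.pure g)) g')
    atTop (𝓝 (M.steady g'))

end Model

end SensorNet

end

namespace SensorNet

/-! ### Deterministic bounds -/

/-! Write `v_k` for the posterior variances and `f(v) = 1/v - 1/ν(v)`, which is `steadySNR`. In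
inverse variances the Kalman update is additive, `1/v_k = 1/ν(v_{k-1}) + Λ_k`, with `1/V₀ = 1` in
slot `0`. Summing, `∑ Λ_k = ∑ f(v_k) + 1/ν(v_T) - 1 ≥ ∑ f(v_k)`, because `ν(v_T) ≤ 1`
(`sum_steadySNR_le`). On `(0,1]` the function `f` is convex and strictly decreasing, and `ν̂*` is
its inverse (`nuStar_spec`). Jensen's inequality, over time and over the randomness, therefore
bounds the mean SNR below by `f` of the mean MSE. If the liminf of the MSE were below `ν̂*(m)`, the
mean SNR would exceed some level above `m` infinitely often. So every upper bound `m` on the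
long-run SNR gives the MSE bound `ν̂*(m)` (`nuStar_le_longRunMSE`), and with `m = maxSNR` this
settles the first claim.

For the single-slot value it remains to show that the long-run SNR is at most `slotMaxSNR`. Time
sharing does this: the single slot imitates a uniformly chosen slot of a long horizon with a weight
`θ < 1`, and idles otherwise. The slack in `θ` is needed because the budget, and in the coordinated
scheme the steady state too, are only reached in the limit (`longRunSNR_le_slotMaxSNR`). With
coordination any law of the actions given the accuracy states is admissible, so the averaged
conditional laws can be used. Without coordination the instruction of the single slot must be
independent of the states; i.i.d. accuracy states ensure this independence from slot `1` on. -/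

/-- The SNR that keeps the posterior variance constantly equal to `v`. -/
noncomputable def steadySNR (α v : ℝ) : ℝ := 1 / v - 1 / nu α v

/-- Minus the derivative of `steadySNR`. -/
noncomputable def steadySlope (α r : ℝ) : ℝ := 1 / r ^ 2 - α / nu α r ^ 2

lemma nu_pos {α v : ℝ} (h0 : 0 ≤ α) (h1 : α < 1) (hv : 0 ≤ v) : 0 < nu α v := by
  unfold nu
  nlinarith [mul_nonneg h0 hv]

lemma nu_le_one {α v : ℝ} (h0 : 0 ≤ α) (hv : v ≤ 1) : nu α v ≤ 1 := by
  unfold nu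
  nlinarith

lemma le_nu {α v : ℝ} (h1 : α < 1) (hv : v ≤ 1) : v ≤ nu α v := by
  unfold nu
  nlinarith

lemma hatNu_pos {V L : ℝ} (hV : 0 < V) (hL : 0 ≤ L) : 0 < hatNu V L := by
  unfold hatNu
  positivity

lemma hatNu_le {V L : ℝ} (hV : 0 < V) (hL : 0 ≤ L) : hatNu V L ≤ V := by
  unfold hatNu
  exact div_le_self hV.le (by nlinarith [mul_nonneg hV.le hL])

lemma one_div_hatNu {V L : ℝ} (hV : 0 < V) : 1 / hatNu V L = 1 / V + L := by
  unfold hatNu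
  rw [one_div_div]
  field_simp

lemma hatNuSeq_mem {α : ℝ} (h0 : 0 ≤ α) (h1 : α < 1) {L : ℕ → ℝ} (hL : ∀ k, 0 ≤ L k) (k : ℕ) :
    0 < hatNuSeq α 1 L k ∧ hatNuSeq α 1 L k ≤ 1 := by
  induction k with
  | zero => exact ⟨hatNu_pos one_pos (hL 0), hatNu_le one_pos (hL 0)⟩
  | succ k ih =>
    have h := nu_pos h0 h1 ih.1.le
    exact ⟨hatNu_pos h (hL _), (hatNu_le h (hL _)).trans (nu_le_one h0 ih.2)⟩

lemma steadySlope_nonneg {α r : ℝ} (h0 : 0 ≤ α) (h1 : α < 1) (hr : 0 < r) (hr1 : r ≤ 1) :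
    0 ≤ steadySlope α r := by
  have hn := nu_pos h0 h1 hr.le
  have hle := le_nu h1 hr1
  unfold steadySlope
  rw [sub_nonneg, div_le_div_iff₀ (by positivity) (by positivity)]
  nlinarith [pow_le_pow_left₀ hr.le hle 2, sq_nonneg r]

/-- Convexity without derivatives: the tangent-line errors of `1/v` and of `1/ν(v)` are explicit
squares over positive denominators, and the second is the smaller one because `v ≤ ν(v)`, `r ≤ ν(r)`
and `α ≤ 1`. -/
lemma steadySNR_tangent {α r v : ℝ} (h0 : 0 ≤ α) (h1 : α < 1) (hr : 0 < r) (hr1 : r ≤ 1)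
    (hv : 0 < v) (hv1 : v ≤ 1) :
    steadySNR α r - steadySlope α r * (v - r) ≤ steadySNR α v := by
  have hn := nu_pos h0 h1 hr.le
  have hm := nu_pos h0 h1 hv.le
  have e1 : 1 / v - 1 / r + 1 / r ^ 2 * (v - r) = (v - r) ^ 2 / (v * r ^ 2) := by
    field_simp
    ring
  have e2 : 1 / nu α v - 1 / nu α r + α / nu α r ^ 2 * (v - r)
      = (α * (v - r)) ^ 2 / (nu α v * nu α r ^ 2) := by
    have : α * (v - r) = nu α v - nu α r := by unfold nu; ring
    rw [div_mul_eq_mul_div, this]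
    field_simp
    ring
  have e3 : (α * (v - r)) ^ 2 / (nu α v * nu α r ^ 2) ≤ (v - r) ^ 2 / (v * r ^ 2) := by
    apply div_le_div₀ (sq_nonneg _) _ (by positivity)
    · exact mul_le_mul (le_nu h1 hv1) (pow_le_pow_left₀ hr.le (le_nu h1 hr1) 2) (by positivity)
        hm.le
    · rw [mul_pow]
      exact mul_le_of_le_one_left (sq_nonneg _) (pow_le_one₀ h0 h1.le)
  unfold steadySNR steadySlope
  nlinarith

lemma sum_steadySNR_le {α : ℝ} (h0 : 0 ≤ α) (h1 : α < 1) {L : ℕ → ℝ} (hL : ∀ k, 0 ≤ L k) (T : ℕ) :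
    ∑ k ∈ Finset.range (T + 1), steadySNR α (hatNuSeq α 1 L k)
      ≤ ∑ k ∈ Finset.range (T + 1), L k := by
  -- The exact telescoped identity; the `1` on the right is `1 / V₀`, and the leftover `1 / ν(v_T)`
  -- is at least `1`.
  suffices h : ∑ k ∈ Finset.range (T + 1), steadySNR α (hatNuSeq α 1 L k)
      + 1 / nu α (hatNuSeq α 1 L T) = ∑ k ∈ Finset.range (T + 1), L k + 1 by
    have hm := hatNuSeq_mem h0 h1 hL T
    have := one_le_one_div (nu_pos h0 h1 hm.1.le) (nu_le_one h0 hm.2)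
    linarith
  induction T with
  | zero =>
    have := one_div_hatNu (V := 1) (L := L 0) one_pos
    simp only [zero_add, Finset.sum_range_one, steadySNR, hatNuSeq]
    linarith
  | succ T ih =>
    rw [Finset.sum_range_succ, Finset.sum_range_succ (fun k => L k)]
    have := one_div_hatNu (L := L (T + 1)) (nu_pos h0 h1 (hatNuSeq_mem h0 h1 hL T).1.le)
    have e : steadySNR α (hatNuSeq α 1 L (T + 1)) = 1 / hatNuSeq α 1 L (T + 1)
        - 1 / nu α (hatNuSeq α 1 L (T + 1)) := rfl
    have e' : hatNuSeq α 1 L (T + 1) = hatNu (nu α (hatNuSeq α 1 L T)) (L (T + 1)) := rfl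
    rw [← e'] at this
    linarith

/-- Jensen's inequality over time, kept in tangent form: the right side is affine in the sample
averages, so it can later be integrated directly for a fixed `r`. -/
lemma steadySNR_le_average {α : ℝ} (h0 : 0 ≤ α) (h1 : α < 1) {L : ℕ → ℝ} (hL : ∀ k, 0 ≤ L k)
    {r : ℝ} (hr : 0 < r) (hr1 : r ≤ 1) (T : ℕ) :
    steadySNR α r ≤ (1 / ((T : ℝ) + 1)) * ∑ k ∈ Finset.range (T + 1), L k
      + steadySlope α r * (sampleMSE α 1 L T - r) := by
  have h := (Finset.sum_le_sum fun k (_ : k ∈ Finset.range (T + 1)) =>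
    steadySNR_tangent h0 h1 hr hr1 (hatNuSeq_mem h0 h1 hL k).1
      (hatNuSeq_mem h0 h1 hL k).2).trans (sum_steadySNR_le h0 h1 hL T)
  rw [Finset.sum_sub_distrib, ← Finset.mul_sum, Finset.sum_sub_distrib] at h
  simp only [Finset.sum_const, Finset.card_range, nsmul_eq_mul, Nat.cast_add, Nat.cast_one] at h
  have hT : (0 : ℝ) < (T : ℝ) + 1 := by positivity
  unfold sampleMSE
  rw [← mul_le_mul_iff_right₀ hT]
  have e : ((T : ℝ) + 1) * ((1 / ((T : ℝ) + 1)) * ∑ k ∈ Finset.range (T + 1), L k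
      + steadySlope α r * ((1 / ((T : ℝ) + 1)) * ∑ k ∈ Finset.range (T + 1), hatNuSeq α 1 L k - r))
      = ∑ k ∈ Finset.range (T + 1), L k
      + steadySlope α r * (∑ k ∈ Finset.range (T + 1), hatNuSeq α 1 L k - (T + 1) * r) := by
    field_simp
  rw [e]
  linarith

lemma sampleMSE_mem {α : ℝ} (h0 : 0 ≤ α) (h1 : α < 1) {L : ℕ → ℝ} (hL : ∀ k, 0 ≤ L k) (T : ℕ) :
    0 ≤ sampleMSE α 1 L T ∧ sampleMSE α 1 L T ≤ 1 := by
  unfold sampleMSE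
  refine ⟨mul_nonneg (by positivity) (Finset.sum_nonneg fun k _ => (hatNuSeq_mem h0 h1 hL k).1.le),
    ?_⟩
  rw [one_div_mul_eq_div, div_le_one (by positivity)]
  refine (Finset.sum_le_card_nsmul _ _ 1 fun k _ => (hatNuSeq_mem h0 h1 hL k).2).trans ?_
  simp

/-- The decrease of `1/v` strictly outweighs that of `1/ν(v)`: the numerator of the latter carries
the factor `α < 1`, and its denominator is at least as large. -/
lemma steadySNR_strictAnti {α r v : ℝ} (h0 : 0 ≤ α) (h1 : α < 1) (hr : 0 < r) (hrv : r < v)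
    (hv : v ≤ 1) : steadySNR α v < steadySNR α r := by
  have hn := nu_pos h0 h1 hr.le
  have hm := nu_pos h0 h1 (hr.trans hrv).le
  have e1 : 1 / r - 1 / v = (v - r) / (r * v) := by
    have := (hr.trans hrv).ne'
    field_simp
  have e2 : 1 / nu α r - 1 / nu α v = α * (v - r) / (nu α r * nu α v) := by
    have : α * (v - r) = nu α v - nu α r := by unfold nu; ring
    rw [this]
    field_simp
  have e3 : α * (v - r) / (nu α r * nu α v) < (v - r) / (r * v) := by
    apply div_lt_div₀ _ _ (by linarith) (mul_pos hr (hr.trans hrv))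
    · exact mul_lt_of_lt_one_left (by linarith) h1
    · exact mul_le_mul (le_nu h1 (hrv.le.trans hv)) (le_nu h1 hv) (by linarith) hn.le
  unfold steadySNR
  linarith

/-- Clearing denominators in `f(n) = x` gives `α x n² + (1 - α)(1 + x) n = 1 - α`, whose positive
root is the closed formula. The degenerate cases `α = 0` and `x = 0` are checked by hand. -/
lemma nuStar_spec {α x : ℝ} (h0 : 0 ≤ α) (h1 : α < 1) (hx : 0 ≤ x) :
    0 < nuStar α x ∧ nuStar α x ≤ 1 ∧ steadySNR α (nuStar α x) = x := by
  by_cases hα : α = 0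
  · have hn : nuStar α x = 1 / (1 + x) := by simp [nuStar, hα]
    rw [hn]
    refine ⟨by positivity, (div_le_one (by positivity)).2 (by linarith), ?_⟩
    simp [steadySNR, nu, hα]
  by_cases hx0 : x = 0
  · have hn : nuStar α x = 1 := by simp [nuStar, hα, hx0]
    rw [hn]
    simp [steadySNR, nu, hx0]
  have hα' : 0 < α := lt_of_le_of_ne h0 (Ne.symm hα)
  have hx' : 0 < x := lt_of_le_of_ne hx (Ne.symm hx0)
  have hn : nuStar α x = (Real.sqrt ((1 - α) ^ 2 * (1 + x ^ 2) + 2 * (1 - α ^ 2) * x)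
      - (1 - α) * (1 + x)) / (2 * α * x) := by simp [nuStar, hα, hx0]
  have ha : 0 < 1 - α := by linarith
  have hax : 0 < α * x := mul_pos hα' hx'
  -- The radicand is the discriminant of this quadratic.
  have hd : (1 - α) ^ 2 * (1 + x ^ 2) + 2 * (1 - α ^ 2) * x
      = ((1 - α) * (1 + x)) ^ 2 + 4 * (α * x) * (1 - α) := by ring
  rw [hd] at hn
  set b := (1 - α) * (1 + x) with hb
  set s := Real.sqrt (b ^ 2 + 4 * (α * x) * (1 - α)) with hs
  have hs2 : s ^ 2 = b ^ 2 + 4 * (α * x) * (1 - α) := Real.sq_sqrt (by positivity)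
  have hbs : b < s := Real.lt_sqrt_of_sq_lt (by nlinarith [mul_pos hax ha])
  set n := nuStar α x
  have hn' : s = 2 * (α * x) * n + b := by
    rw [hn]
    field_simp
    ring
  have hn0 : 0 < n := by
    rw [hn]
    exact div_pos (by linarith) (by positivity)
  have hq : α * x * n ^ 2 + b * n = 1 - α := by
    rw [hn'] at hs2
    have : 4 * (α * x) * (α * x * n ^ 2 + b * n) = 4 * (α * x) * (1 - α) := by linear_combination hs2
    exact mul_left_cancel₀ (by positivity) this
  -- For `n > 1` the linear term alone would exceed `1 - α`.
  have hn1 : n ≤ 1 := by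
    by_contra hc
    push Not at hc
    have h2 : 0 < (1 - α) * x := mul_pos ha hx'
    have h3 : b < b * n := by
      have : 0 < b := mul_pos ha (by linarith)
      nlinarith
    have h4 : 0 < α * x * n ^ 2 := by positivity
    rw [hb] at h3 hq
    nlinarith
  refine ⟨hn0, hn1, ?_⟩
  have hν := nu_pos h0 h1 hn0.le
  have : 1 / n - 1 / nu α n = (nu α n - n) / (n * nu α n) := by field_simp
  unfold steadySNR
  rw [this, div_eq_iff (by positivity)]
  unfold nu
  rw [hb] at hq
  linear_combination -hq

namespace Model
variable {M : Model}

/-! ### One-slot laws as iterated integrals -/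

lemma stateKernel_singleton (g g' : M.State) :
    M.stateKernel g {g'} = ∏ n, M.trans (g n) (g' n) := by
  change (Measure.pi fun n => (M.trans (g n)).toMeasure) {g'} = _
  rw [Measure.pi_singleton]
  exact Finset.prod_congr rfl fun n _ =>
    PMF.toMeasure_apply_singleton _ _ (measurableSet_singleton _)

namespace Scheme
variable {s : Scheme M}

instance (p : PMF M.State) : IsProbabilityMeasure (s.startLaw p) := by
  unfold startLaw
  exact Measure.isProbabilityMeasure_map (measurable_of_countable _).aemeasurable

instance (δ : s.Policy) (p₀ : PMF M.State) : IsProbabilityMeasure (δ.initial p₀) := by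
  unfold Policy.initial
  infer_instance

instance (δ : s.Policy) (p₀ : PMF M.State) : IsProbabilityMeasure (δ.law p₀) := by
  unfold Policy.law
  infer_instance

lemma lintegral_startLaw (p : PMF M.State) {f : M.Belief × M.State → ℝ≥0∞} (hf : Measurable f) :
    ∫⁻ z, f z ∂(s.startLaw p)
      = ∑ g, p g * f (s.belief (fun g' => (p g').toReal) g, g) := by
  unfold startLaw
  rw [lintegral_map hf (measurable_of_countable _), lintegral_fintype]
  refine Finset.sum_congr rfl fun g _ => ?_
  rw [PMF.toMeasure_apply_singleton _ _ (measurableSet_singleton _), mul_comm]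

lemma lintegral_decide (δ : s.Policy) (k : ℕ) (z : ℝ × M.Belief × M.State)
    {f : s.Instr × M.Action → ℝ≥0∞} (hf : Measurable f) :
    ∫⁻ w, f w ∂(δ.decide k z)
      = ∫⁻ d, ∫⁻ x, f (d, x) ∂(s.act (d, z.2.2)) ∂(δ.draw k (z.1, z.2.1)) := by
  unfold Policy.decide
  rw [Kernel.lintegral_compProd _ _ _ hf, Kernel.comap_apply]
  simp only [Kernel.comap_apply]

lemma lintegral_advance (y : s.Slot) {f : ℝ × M.Belief × M.State → ℝ≥0∞} (hf : Measurable f) :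
    ∫⁻ z, f z ∂(s.advance y)
      = ∑ g', (∏ n, M.trans (y.1.2.2 n) (g' n)) * f (s.next (y, g')) := by
  unfold advance
  have hm := s.measurable_next
  rw [Kernel.lintegral_map _ hm _ hf, Kernel.lintegral_id_prod (f := fun p => f (s.next p)) (hf.comp hm), lintegral_fintype]
  refine Finset.sum_congr rfl fun g' _ => ?_
  rw [Kernel.comap_apply, stateKernel_singleton, mul_comm]

lemma lintegral_step (δ : s.Policy) (k : ℕ) (y : s.Slot) {f : s.Slot → ℝ≥0∞} (hf : Measurable f) :
    ∫⁻ z, f z ∂(δ.step k y)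
      = ∑ g', (∏ n, M.trans (y.1.2.2 n) (g' n)) *
        ∫⁻ w, f (s.next (y, g'), w) ∂(δ.decide (k + 1) (s.next (y, g'))) := by
  unfold Policy.step
  rw [Kernel.lintegral_compProd _ _ _ hf]
  simp only [Kernel.prodMkLeft_apply]
  exact lintegral_advance y (f := fun z => ∫⁻ w, f (z, w) ∂(δ.decide (k + 1) z))
    (hf.lintegral_kernel_prod_right' (κ := δ.decide (k + 1)))

lemma lintegral_initial (δ : s.Policy) (p₀ : PMF M.State) {f : s.Slot → ℝ≥0∞}
    (hf : Measurable f) :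
    ∫⁻ z, f z ∂(δ.initial p₀) = ∑ g, p₀ g *
      ∫⁻ w, f ((1, s.belief (fun g' => (p₀ g').toReal) g, g), w)
        ∂(δ.decide 0 (1, s.belief (fun g' => (p₀ g').toReal) g, g)) := by
  unfold Policy.initial
  have h := hf.lintegral_kernel_prod_right' (κ := δ.decide 0)
  rw [Measure.lintegral_compProd hf, lintegral_prod _ h.aemeasurable, lintegral_dirac' _ ?_,
    lintegral_startLaw]
  · exact h.comp measurable_prodMk_left
  · exact h.lintegral_prod_right'

/-! ### Marginals of the process -/

lemma lintegral_law_zero (δ : s.Policy) (p₀ : PMF M.State) {f : s.Slot → ℝ≥0∞}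
    (hf : Measurable f) :
    ∫⁻ ω, f (ω 0) ∂(δ.law p₀) = ∫⁻ z, f z ∂(δ.initial p₀) := by
  have h : (δ.law p₀).map (fun ω => ω 0) = δ.initial p₀ := by
    unfold Policy.law Kernel.trajMeasure
    have e : (fun ω : ℕ → s.Slot => ω 0)
        = (fun h : (i : Finset.Iic 0) → s.Slot => h ⟨0, by simp⟩) ∘ Preorder.frestrictLe 0 := rfl
    rw [e, ← Measure.map_map (by fun_prop) (by fun_prop), Measure.map_comp _ _ (by fun_prop),
      Kernel.traj_map_frestrictLe, Kernel.partialTraj_self, Measure.id_comp,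
      Measure.map_map (by fun_prop) (by fun_prop)]
    exact Measure.map_id
  rw [← h, lintegral_map hf (measurable_pi_apply 0)]

/-- Markov property: the trajectory kernel sees the whole history but reads only its last slot. -/
lemma lintegral_law_succ (δ : s.Policy) (p₀ : PMF M.State) (k : ℕ) {f : s.Slot → ℝ≥0∞}
    (hf : Measurable f) :
    ∫⁻ ω, f (ω (k + 1)) ∂(δ.law p₀) = ∫⁻ ω, ∫⁻ z, f z ∂(δ.step k (ω k)) ∂(δ.law p₀) := by
  have h := Kernel.map_frestrictLe_trajMeasure_compProd_eq_map_trajMeasure (X := fun _ => s.Slot)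
    (μ₀ := δ.initial p₀) (κ := fun k => (δ.step k).comap
      (fun h : (i : Finset.Iic k) → s.Slot => h ⟨k, by simp⟩) (by fun_prop)) (a := k)
  change (δ.law p₀).map _ ⊗ₘ _ = (δ.law p₀).map _ at h
  have h2 : ∫⁻ ω, f (ω (k + 1)) ∂(δ.law p₀) = ∫⁻ q, f q.2
      ∂((δ.law p₀).map fun x => (Preorder.frestrictLe k x, x (k + 1))) := by
    rw [lintegral_map (by fun_prop) (by fun_prop)]
  rw [h2, ← h, Measure.lintegral_compProd (by fun_prop), lintegral_map ?_ (by fun_prop)]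
  · rfl
  · exact (by fun_prop : Measurable fun q : ((i : Finset.Iic k) → s.Slot) × s.Slot => f q.2
      ).lintegral_kernel_prod_right' (κ := (δ.step k).comap
      (fun h : (i : Finset.Iic k) → s.Slot => h ⟨k, by simp⟩) (by fun_prop))

end Scheme

/-! ### Bounds on the aggregate SNR and the cost -/

lemma N_pos (M : Model) : 0 < M.N := M.one_le_B.trans M.B_le_N

variable (M) in
/-- A bound on the local SNR. -/
noncomputable def localBound : ℝ := (∑ g ∈ M.Γ, g ^ 2) * M.SA

variable (M) in
/-- A bound on the aggregate SNR. -/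
noncomputable def snrBound : ℝ := M.N * M.localBound

lemma localSNR_nonneg (g : ℝ) (s : ℝ≥0) : 0 ≤ M.localSNR g s := by
  have := M.SA_pos
  unfold localSNR
  positivity

lemma localBound_nonneg : 0 ≤ M.localBound :=
  mul_nonneg (Finset.sum_nonneg fun g _ => sq_nonneg g) M.SA_pos.le

lemma localSNR_le (g : M.Γ) (s : ℝ≥0) : M.localSNR (g : ℝ) s ≤ M.localBound := by
  have h := M.SA_pos
  have hs : 0 ≤ (s : ℝ) := s.2
  unfold localSNR localBound
  -- Accuracy states are bounded only from above, so `g ^ 2` may exceed `1`; the sum of squares over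
  -- the finite set `Γ` bounds it in all cases.
  refine mul_le_mul (Finset.single_le_sum (f := fun g : ℝ => g ^ 2) (fun g _ => sq_nonneg g) g.2) ?_
    (by positivity) (Finset.sum_nonneg fun g _ => sq_nonneg g)
  rw [div_le_iff₀ (by positivity)]
  nlinarith

lemma aggSNR_nonneg (x : M.Action) (g : M.State) : 0 ≤ aggSNR x g := by
  unfold aggSNR
  refine Finset.sum_nonneg fun n _ => ?_
  split_ifs
  · exact localSNR_nonneg _ _
  · exact le_rfl

lemma aggSNR_le (x : M.Action) (g : M.State) : aggSNR x g ≤ M.snrBound := by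
  unfold aggSNR
  refine (Finset.sum_le_card_nsmul _ _ M.localBound fun n _ => ?_).trans ?_
  · split_ifs
    · exact localSNR_le _ _
    · exact localBound_nonneg
  · simp [snrBound]

lemma snrBound_nonneg : 0 ≤ M.snrBound :=
  mul_nonneg (Nat.cast_nonneg _) localBound_nonneg

lemma cost_nonneg (x : M.Action) (n : Fin M.N) : 0 ≤ cost x n := by
  have h1 := M.cTX_pos
  have h2 := M.φ_nonneg
  unfold cost
  split_ifs
  · positivity
  · exact le_rfl

lemma measurable_cost (n : Fin M.N) : Measurable fun x : M.Action => cost x n := by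
  unfold cost
  refine Measurable.ite ?_ (by fun_prop) measurable_const
  exact (by fun_prop : Measurable fun x : M.Action => (x n).1) (measurableSet_singleton true)

/-- The cost of one SN, as a function of the actions and the accuracy states. -/
noncomputable def costE (n : Fin M.N) (q : M.Action × M.State) : ℝ≥0∞ := ENNReal.ofReal (cost q.1 n)

/-- The aggregate SNR, as an extended nonnegative real. -/
noncomputable def snrE (q : M.Action × M.State) : ℝ≥0∞ := ENNReal.ofReal (aggSNR q.1 q.2)

lemma measurable_costE (n : Fin M.N) : Measurable (costE (M := M) n) :=
  ENNReal.measurable_ofReal.comp ((measurable_cost n).comp measurable_fst)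

lemma measurable_snrE : Measurable (snrE (M := M)) :=
  ENNReal.measurable_ofReal.comp measurable_aggSNR

lemma snrE_le (q : M.Action × M.State) : snrE q ≤ ENNReal.ofReal M.snrBound :=
  ENNReal.ofReal_le_ofReal (aggSNR_le _ _)

lemma measurable_hatNuSeq {Ω : Type*} [MeasurableSpace Ω] (α : ℝ) {L : Ω → ℕ → ℝ}
    (hL : ∀ k, Measurable fun ω => L ω k) (k : ℕ) :
    Measurable fun ω => hatNuSeq α 1 (L ω) k := by
  induction k with
  | zero =>
    have := hL 0
    simp only [hatNuSeq, hatNu]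
    fun_prop
  | succ k ih =>
    have := hL (k + 1)
    simp only [hatNuSeq, hatNu, nu]
    fun_prop

namespace Scheme
variable {s : Scheme M}

lemma snr_nonneg (ω : ℕ → s.Slot) (k : ℕ) : 0 ≤ s.snr ω k := aggSNR_nonneg _ _

lemma snr_le (ω : ℕ → s.Slot) (k : ℕ) : s.snr ω k ≤ M.snrBound := aggSNR_le _ _

lemma measurable_snr (k : ℕ) : Measurable fun ω : ℕ → s.Slot => s.snr ω k :=
  measurable_aggSNR.comp (by fun_prop : Measurable fun ω : ℕ → s.Slot =>
    ((ω k).2.2, (ω k).1.2.2))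

lemma integrable_snr (δ : s.Policy) (p₀ : PMF M.State) (k : ℕ) :
    Integrable (fun ω => s.snr ω k) (δ.law p₀) :=
  Integrable.of_bound (measurable_snr k).aestronglyMeasurable M.snrBound
    (Eventually.of_forall fun ω => by
      rw [Real.norm_of_nonneg (snr_nonneg ω k)]
      exact snr_le ω k)

lemma integrable_sampleMSE (δ : s.Policy) (p₀ : PMF M.State) (T : ℕ) :
    Integrable (fun ω => sampleMSE M.α 1 (s.snr ω) T) (δ.law p₀) := by
  refine Integrable.of_bound (C := 1) ?_ (Eventually.of_forall fun ω => ?_)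
  · unfold sampleMSE
    exact (Measurable.const_mul (Finset.measurable_sum _ fun k _ =>
      measurable_hatNuSeq M.α measurable_snr k) _).aestronglyMeasurable
  · have h := sampleMSE_mem M.α_nonneg M.α_lt_one (snr_nonneg ω) T
    rw [Real.norm_of_nonneg h.1]
    exact h.2

lemma mse_nonneg (δ : s.Policy) (p₀ : PMF M.State) (T : ℕ) : 0 ≤ δ.mse p₀ T :=
  integral_nonneg fun ω =>
    (sampleMSE_mem M.α_nonneg M.α_lt_one (snr_nonneg ω) T).1

lemma mse_le_one (δ : s.Policy) (p₀ : PMF M.State) (T : ℕ) : δ.mse p₀ T ≤ 1 := by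
  have h := integral_mono (integrable_sampleMSE δ p₀ T) (integrable_const 1) fun ω =>
    (sampleMSE_mem M.α_nonneg M.α_lt_one (snr_nonneg ω) T).2
  simpa [Policy.mse] using h

lemma avgSNR_nonneg (δ : s.Policy) (p₀ : PMF M.State) (T : ℕ) : 0 ≤ δ.avgSNR p₀ T :=
  mul_nonneg (by positivity) (Finset.sum_nonneg fun _ _ =>
    integral_nonneg fun _ => aggSNR_nonneg _ _)

lemma avgSNR_le (δ : s.Policy) (p₀ : PMF M.State) (T : ℕ) : δ.avgSNR p₀ T ≤ M.snrBound := by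
  unfold Policy.avgSNR
  have h : ∀ k ∈ Finset.range (T + 1), ∫ ω, s.snr ω k ∂(δ.law p₀) ≤ M.snrBound := fun k _ => by
    simpa using integral_mono (integrable_snr δ p₀ k) (integrable_const M.snrBound) fun ω =>
      snr_le ω k
  rw [one_div_mul_eq_div, div_le_iff₀ (by positivity)]
  refine (Finset.sum_le_card_nsmul _ _ _ h).trans ?_
  simp [mul_comm]

lemma longRunSNR_nonneg (δ : s.Policy) (p₀ : PMF M.State) : 0 ≤ δ.longRunSNR p₀ :=
  le_limsup_of_frequently_le (Eventually.of_forall fun T => avgSNR_nonneg δ p₀ T).frequently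
    (isBoundedUnder_of ⟨M.snrBound, avgSNR_le δ p₀⟩)

lemma longRunSNR_le_snrBound (δ : s.Policy) (p₀ : PMF M.State) :
    δ.longRunSNR p₀ ≤ M.snrBound :=
  limsup_le_of_le (IsBoundedUnder.isCoboundedUnder_le (isBoundedUnder_of ⟨0, avgSNR_nonneg δ p₀⟩))
    (Eventually.of_forall (avgSNR_le δ p₀))

/-- The uniform bound `snrBound` is essential: a supremum in `ℝ` is meaningful only for a set
bounded above. -/
lemma longRunSNR_le_maxSNR (δ : s.Policy) (p₀ : PMF M.State) (h : δ.Feasible p₀) :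
    δ.longRunSNR p₀ ≤ s.maxSNR p₀ :=
  le_csSup ⟨M.snrBound, by rintro _ ⟨δ', -, rfl⟩; exact longRunSNR_le_snrBound δ' p₀⟩ ⟨δ, h, rfl⟩

/-! ### The MSE bound in terms of the SNR -/

/-- Expectation of the tangent inequality at `r`; the slope term is then nonpositive because the
mean MSE is at most `r`. -/
lemma steadySNR_le_avgSNR (δ : s.Policy) (p₀ : PMF M.State) {r : ℝ} (hr : 0 < r) (hr1 : r ≤ 1)
    (T : ℕ) (h : δ.mse p₀ T ≤ r) : steadySNR M.α r ≤ δ.avgSNR p₀ T := by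
  have hi : Integrable (fun ω => (1 / ((T : ℝ) + 1)) * ∑ k ∈ Finset.range (T + 1), s.snr ω k)
      (δ.law p₀) := (integrable_finsetSum _ fun k _ => integrable_snr δ p₀ k).const_mul _
  have hj : Integrable (fun ω => steadySlope M.α r * (sampleMSE M.α 1 (s.snr ω) T - r))
      (δ.law p₀) := ((integrable_sampleMSE δ p₀ T).sub (integrable_const r)).const_mul _
  have key := integral_mono (integrable_const (steadySNR M.α r)) (hi.add hj) fun ω =>
    steadySNR_le_average M.α_nonneg M.α_lt_one
      (snr_nonneg ω) hr hr1 T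
  rw [integral_add' hi hj, integral_const_mul, integral_const_mul,
    integral_finsetSum _ (fun k _ => integrable_snr δ p₀ k),
    integral_sub (integrable_sampleMSE δ p₀ T) (integrable_const r)] at key
  simp only [integral_const, probReal_univ, smul_eq_mul, one_mul] at key
  have h2 : steadySlope M.α r * (δ.mse p₀ T - r) ≤ 0 :=
    mul_nonpos_of_nonneg_of_nonpos (steadySlope_nonneg M.α_nonneg M.α_lt_one hr hr1) (by linarith)
  unfold Policy.avgSNR
  unfold Policy.mse at h2
  linarith

lemma nuStar_le_longRunMSE (δ : s.Policy) (p₀ : PMF M.State) {m : ℝ} (h : δ.longRunSNR p₀ ≤ m) :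
    nuStar M.α m ≤ δ.longRunMSE p₀ := by
  obtain ⟨h0, h1, h2⟩ := nuStar_spec M.α_nonneg M.α_lt_one ((longRunSNR_nonneg δ p₀).trans h)
  by_contra hc
  push Not at hc
  -- A fixed `r` strictly between the liminf and `nuStar M.α m`: the MSE is frequently below `r`,
  -- while the SNR is eventually below `steadySNR M.α r`, which exceeds `m`.
  obtain ⟨r, hr, hr'⟩ := exists_between hc
  have hf : ∃ᶠ T in atTop, δ.mse p₀ T < r := frequently_lt_of_liminf_lt
    (IsBoundedUnder.isCoboundedUnder_ge (isBoundedUnder_of ⟨1, mse_le_one δ p₀⟩)) hr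
  obtain ⟨T₀, hT₀⟩ := hf.exists
  have hr0 : 0 < r := (mse_nonneg δ p₀ T₀).trans_lt hT₀
  have hlt : m < steadySNR M.α r := by
    have := steadySNR_strictAnti M.α_nonneg M.α_lt_one hr0 hr' h1
    rwa [h2] at this
  have he : ∀ᶠ T in atTop, δ.avgSNR p₀ T < steadySNR M.α r :=
    eventually_lt_of_limsup_lt (h.trans_lt hlt) (isBoundedUnder_of ⟨M.snrBound, avgSNR_le δ p₀⟩)
  obtain ⟨T, hT, hT'⟩ := (hf.and_eventually he).exists
  exact (steadySNR_le_avgSNR δ p₀ hr0 (hr'.le.trans h1) T hT.le).not_gt hT'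

/-! ### Averages as extended nonnegative reals -/

/-- Actions and accuracy states of a slot. -/
def slotPair (z : s.Slot) : M.Action × M.State := (z.2.2, z.1.2.2)

lemma measurable_slotPair : Measurable (slotPair : s.Slot → M.Action × M.State) := by
  unfold slotPair
  fun_prop

/-- Time average of the expectation of a function of the actions and of the accuracy states. -/
noncomputable def Policy.avg (δ : s.Policy) (p₀ : PMF M.State) (f : M.Action × M.State → ℝ≥0∞)
    (T : ℕ) : ℝ≥0∞ :=
  ((T : ℝ≥0∞) + 1)⁻¹ * ∑ k ∈ Finset.range (T + 1), ∫⁻ ω, f (slotPair (ω k)) ∂(δ.law p₀)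

/-- Expectation of a function of the actions and of the accuracy states in a single slot. -/
noncomputable def slotAvg (s : Scheme M) (p : PMF M.State) (K : Kernel M.Belief s.Instr)
    (f : M.Action × M.State → ℝ≥0∞) : ℝ≥0∞ :=
  ∫⁻ z, f (z.2.2, z.1.2) ∂(s.slotLaw p K)

lemma avgCost_eq (δ : s.Policy) (p₀ : PMF M.State) (n : Fin M.N) (T : ℕ) :
    δ.avgCost p₀ n T = δ.avg p₀ (costE n) T := by
  unfold Policy.avgCost Policy.avg
  have hm : ∀ k, Measurable fun ω : ℕ → s.Slot => costE n (slotPair (ω k)) := fun k =>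
    (measurable_costE n).comp (measurable_slotPair.comp (measurable_pi_apply k))
  rw [← lintegral_finsetSum _ (fun k _ => hm k), ← lintegral_const_mul _
    (Finset.measurable_sum _ fun k _ => hm k)]
  refine lintegral_congr fun ω => ?_
  rw [ENNReal.ofReal_mul (by positivity), ENNReal.ofReal_sum_of_nonneg fun k _ => cost_nonneg _ _,
    one_div, ENNReal.ofReal_inv_of_pos (by positivity),
    ENNReal.ofReal_add (by positivity) zero_le_one, ENNReal.ofReal_natCast, ENNReal.ofReal_one]
  rfl

lemma lintegral_snrE_le (δ : s.Policy) (p₀ : PMF M.State) (k : ℕ) :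
    ∫⁻ ω, snrE (slotPair (ω k)) ∂(δ.law p₀) ≤ ENNReal.ofReal M.snrBound := by
  refine (lintegral_mono fun ω => snrE_le _).trans ?_
  rw [lintegral_const, measure_univ, mul_one]

lemma avgSNR_eq (δ : s.Policy) (p₀ : PMF M.State) (T : ℕ) :
    δ.avgSNR p₀ T = (δ.avg p₀ snrE T).toReal := by
  unfold Policy.avgSNR Policy.avg
  have h : ∀ k, ∫ ω, s.snr ω k ∂(δ.law p₀)
      = (∫⁻ ω, snrE (slotPair (ω k)) ∂(δ.law p₀)).toReal := fun k =>
    integral_eq_lintegral_of_nonneg_ae (Eventually.of_forall fun ω => aggSNR_nonneg _ _)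
      (measurable_snr k).aestronglyMeasurable
  have hfin : ∀ k, ∫⁻ ω, snrE (slotPair (ω k)) ∂(δ.law p₀) ≠ ⊤ := fun k =>
    ne_top_of_le_ne_top ENNReal.ofReal_ne_top (lintegral_snrE_le δ p₀ k)
  rw [ENNReal.toReal_mul, ENNReal.toReal_sum fun k _ => hfin k, ENNReal.toReal_inv,
    ENNReal.toReal_add (by simp) (by simp), ENNReal.toReal_natCast, ENNReal.toReal_one, one_div]
  simp only [h]

instance (p : PMF M.State) (K : Kernel M.Belief s.Instr) [IsMarkovKernel K] :
    IsProbabilityMeasure (s.slotLaw p K) := by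
  unfold slotLaw
  infer_instance

lemma integral_slotLaw_eq (p : PMF M.State) (K : Kernel M.Belief s.Instr) :
    ∫ z, aggSNR z.2.2 z.1.2 ∂(s.slotLaw p K) = (s.slotAvg p K snrE).toReal :=
  integral_eq_lintegral_of_nonneg_ae (Eventually.of_forall fun z => aggSNR_nonneg _ _)
    (measurable_aggSNR.comp (by fun_prop : Measurable
      fun z : (M.Belief × M.State) × (s.Instr × M.Action) =>
        (z.2.2, z.1.2))).aestronglyMeasurable

lemma slotAvg_snrE_le (p : PMF M.State) (K : Kernel M.Belief s.Instr) [IsMarkovKernel K] :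
    s.slotAvg p K snrE ≤ ENNReal.ofReal M.snrBound := by
  unfold slotAvg
  refine (lintegral_mono fun z => snrE_le _).trans ?_
  simp

lemma le_slotMaxSNR (p : PMF M.State) (K : Kernel M.Belief s.Instr) [hK : IsMarkovKernel K]
    (h : ∀ n, s.slotAvg p K (costE n) ≤ ENNReal.ofReal (M.ε / M.N)) :
    (s.slotAvg p K snrE).toReal ≤ s.slotMaxSNR p := by
  rw [← integral_slotLaw_eq]
  refine le_csSup ⟨M.snrBound, ?_⟩ ⟨K, hK, h, rfl⟩
  rintro _ ⟨K', hK', -, rfl⟩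
  rw [integral_slotLaw_eq]
  exact ENNReal.toReal_le_of_le_ofReal snrBound_nonneg (slotAvg_snrE_le p K')

lemma slotMaxSNR_nonneg (p : PMF M.State) : 0 ≤ s.slotMaxSNR p := by
  refine Real.sSup_nonneg ?_
  rintro _ ⟨K, -, -, rfl⟩
  exact integral_nonneg fun z => aggSNR_nonneg _ _

/-- If, up to a factor `θ < 1` and a vanishing error, the long-term averages are matched in a single
slot, then the long-term SNR is at most the single-slot value. -/
lemma longRunSNR_le_slotMaxSNR (δ : s.Policy) (p₀ p : PMF M.State) (hδ : δ.Feasible p₀)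
    (e : ℕ → ℝ≥0∞) (he : Tendsto e atTop (𝓝 0))
    (H : ∀ θ : ℝ≥0, θ < 1 → ∀ᶠ T in atTop, ∃ K : Kernel M.Belief s.Instr, IsMarkovKernel K ∧
      (∀ n, s.slotAvg p K (costE n) ≤ θ * δ.avg p₀ (costE n) T) ∧
      θ * δ.avg p₀ snrE T ≤ s.slotAvg p K snrE + e T) :
    δ.longRunSNR p₀ ≤ s.slotMaxSNR p := by
  by_contra hc
  push Not at hc
  obtain ⟨r, hr, hr'⟩ := exists_between hc
  have hS := slotMaxSNR_nonneg (s := s) p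
  have hr0 : 0 < r := hS.trans_lt hr
  -- The factor `t < 1` is so close to `1` that `t * r` still exceeds the single-slot value; the gap
  -- `t * r - slotMaxSNR` will absorb the error `e T`.
  obtain ⟨t, ht, ht1⟩ := exists_between ((div_lt_one hr0).2 hr)
  have ht0 : 0 < t := (div_nonneg hS hr0.le).trans_lt ht
  rw [div_lt_iff₀ hr0] at ht
  lift t to ℝ≥0 using ht0.le
  have ht0' : 0 < t := by exact_mod_cast ht0
  have hb : (0 : ℝ) < M.ε / M.N := div_pos M.ε_pos (by exact_mod_cast M.N_pos)
  have hcost : ∀ᶠ T in atTop, ∀ n, t * δ.avg p₀ (costE n) T ≤ ENNReal.ofReal (M.ε / M.N) := by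
    rw [eventually_all]
    intro n
    -- Scaling by `t` turns the asymptotic constraint into an exact one at every large horizon,
    -- since `ε / N < (ε / N) / t`.
    have h1 : limsup (δ.avgCost p₀ n) atTop < ENNReal.ofReal (M.ε / M.N) / t := by
      refine (hδ n).trans_lt ?_
      rw [ENNReal.lt_div_iff_mul_lt (Or.inl (by exact_mod_cast ht0'.ne')) (Or.inl (by simp))]
      have : ENNReal.ofReal (M.ε / M.N) * t < ENNReal.ofReal (M.ε / M.N) * 1 := by
        refine ENNReal.mul_lt_mul_right (by simpa using hb) ENNReal.ofReal_ne_top ?_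
        exact_mod_cast ht1
      simpa using this
    filter_upwards [eventually_lt_of_limsup_lt h1] with T hT
    rw [avgCost_eq, ENNReal.lt_div_iff_mul_lt (Or.inl (by exact_mod_cast ht0'.ne'))
      (Or.inl (by simp))] at hT
    rw [mul_comm]
    exact hT.le
  have hf : ∃ᶠ T in atTop, r < δ.avgSNR p₀ T := frequently_lt_of_lt_limsup
    (IsBoundedUnder.isCoboundedUnder_le (isBoundedUnder_of ⟨0, avgSNR_nonneg δ p₀⟩)) hr'
  have he' : ∀ᶠ T in atTop, e T < ENNReal.ofReal (t * r - s.slotMaxSNR p) :=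
    he.eventually_lt_const (by simpa using ht)
  obtain ⟨T, hT, ⟨h1, h2⟩, K, hK, h3, h4⟩ :=
    (hf.and_eventually ((hcost.and he').and (H t (by exact_mod_cast ht1)))).exists
  have h5 := le_slotMaxSNR p K fun n => (h3 n).trans (h1 n)
  have h6 := ENNReal.toReal_mono (ENNReal.add_ne_top.2
    ⟨ne_top_of_le_ne_top ENNReal.ofReal_ne_top (slotAvg_snrE_le p K), h2.ne_top⟩) h4
  rw [ENNReal.toReal_mul, ENNReal.toReal_add (ne_top_of_le_ne_top ENNReal.ofReal_ne_top
    (slotAvg_snrE_le p K)) h2.ne_top, ← avgSNR_eq, ENNReal.coe_toReal] at h6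
  have h7 : (e T).toReal < t * r - s.slotMaxSNR p := by
    rw [← ENNReal.toReal_ofReal (by linarith : 0 ≤ t * r - s.slotMaxSNR p)]
    exact ENNReal.toReal_strict_mono ENNReal.ofReal_ne_top h2
  have h8 : (t : ℝ) * r < t * δ.avgSNR p₀ T := mul_lt_mul_of_pos_left hT ht0
  linarith

end Scheme

variable (M) in
/-- All SNs are idle. -/
def idleAction : M.Action := fun _ => (false, 0, ⟨0, M.one_le_B⟩)

lemma costE_of_idle {x : M.Action} {n : Fin M.N} (h : (x n).1 = false) (g : M.State) :
    costE n (x, g) = 0 := by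
  simp [costE, cost, h]

namespace Scheme
variable {s : Scheme M}

lemma slotAvg_eq (p : PMF M.State) (K : Kernel M.Belief s.Instr) [IsMarkovKernel K]
    {f : M.Action × M.State → ℝ≥0∞} (hf : Measurable f) :
    s.slotAvg p K f = ∑ g, p g * ∫⁻ d, ∫⁻ x, f (x, g) ∂(s.act (d, g))
      ∂(K (s.belief (fun g' => (p g').toReal) g)) := by
  unfold slotAvg slotLaw
  have hF : Measurable fun z : (M.Belief × M.State) × (s.Instr × M.Action) =>
      f (z.2.2, z.1.2) := by fun_prop
  rw [Measure.lintegral_compProd hF, lintegral_startLaw p hF.lintegral_kernel_prod_right']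
  refine Finset.sum_congr rfl fun g _ => ?_
  congr 1
  rw [Kernel.lintegral_compProd _ _ _ (by fun_prop), Kernel.comap_apply]
  simp only [Kernel.comap_apply]

lemma tendsto_const_mul_inv_atTop (C : ℝ≥0∞) (hC : C ≠ ⊤) :
    Tendsto (fun T : ℕ => C * ((T : ℝ≥0∞) + 1)⁻¹) atTop (𝓝 0) := by
  have h : Tendsto (fun T : ℕ => ((T : ℝ≥0∞) + 1)⁻¹) atTop (𝓝 0) := by
    have := (tendsto_add_atTop_iff_nat 1).2 ENNReal.tendsto_inv_nat_nhds_zero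
    simpa using this
  simpa using ENNReal.Tendsto.const_mul h (Or.inr hC)

end Scheme

/-! ### Time sharing in the decentralized scheme -/

variable (M) in
/-- The instruction of the decentralized scheme that keeps all SNs idle. -/
def idleInstr : M.DecInstr := (fun _ => 0, fun _ => 0)

/-- Expectation of a function of the actions and of the accuracy states, given the instruction. -/
noncomputable def decMean (p : PMF M.State) (f : M.Action × M.State → ℝ≥0∞) (d : M.DecInstr) :
    ℝ≥0∞ :=
  ∑ g, p g * ∫⁻ x, f (x, g) ∂(M.decAct (d, g))

lemma measurable_lintegral_decAct {f : M.Action × M.State → ℝ≥0∞} (hf : Measurable f)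
    (g : M.State) : Measurable fun d => ∫⁻ x, f (x, g) ∂(M.decAct (d, g)) :=
  (Measurable.lintegral_kernel (κ := M.decAct) (f := fun x => f (x, g)) (by fun_prop)).comp
    (by fun_prop : Measurable fun d : M.DecInstr => (d, g))

lemma measurable_decMean (p : PMF M.State) {f : M.Action × M.State → ℝ≥0∞} (hf : Measurable f) :
    Measurable (decMean p f) := by
  unfold decMean
  exact Finset.measurable_sum _ fun g _ => (measurable_lintegral_decAct hf g).const_mul _

lemma lintegral_decMean (p : PMF M.State) {f : M.Action × M.State → ℝ≥0∞} (hf : Measurable f)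
    (κ : Measure M.DecInstr) :
    ∫⁻ d, decMean p f d ∂κ = ∑ g, p g * ∫⁻ d, ∫⁻ x, f (x, g) ∂(M.decAct (d, g)) ∂κ := by
  unfold decMean
  rw [lintegral_finsetSum _ fun g _ => (measurable_lintegral_decAct hf g).const_mul _]
  exact Finset.sum_congr rfl fun g _ => lintegral_const_mul _ (measurable_lintegral_decAct hf g)

lemma sum_pmf {ι : Type*} [Fintype ι] (p : PMF ι) : ∑ i, p i = 1 := by
  simpa only [tsum_fintype] using p.tsum_coe

lemma sum_lintegral_const (p : PMF M.State) (f : M.DecInstr → ℝ≥0∞) (κ : Measure M.DecInstr) :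
    ∑ g, p g * ∫⁻ d, ∫⁻ _, f d ∂(M.decAct (d, g)) ∂κ = ∫⁻ d, f d ∂κ := by
  simp only [lintegral_const, measure_univ, mul_one]
  rw [← Finset.sum_mul, sum_pmf, one_mul]

/-- Access choices in which SN `n` is active have probability zero, and in the others it pays
nothing. -/
lemma decMean_costE_idleInstr (p : PMF M.State) (n : Fin M.N) :
    decMean p (costE n) M.idleInstr = 0 := by
  unfold decMean
  refine Finset.sum_eq_zero fun g _ => ?_
  have : ∫⁻ x, costE n (x, g) ∂(M.decAct (M.idleInstr, g)) = 0 := by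
    change ∫⁻ x, costE n (x, g) ∂(∑ t : M.Access,
      ENNReal.ofReal (∏ m, choiceProb M.B (M.idleInstr.1 (g m) : ℝ) (t m)) •
        Measure.dirac (fun m => ((t m).1, M.idleInstr.2 (g m), (t m).2))) = 0
    have hm : Measurable fun x : M.Action => costE n (x, g) :=
      (measurable_costE n).comp measurable_prodMk_right
    rw [lintegral_finsetSum_measure]
    refine Finset.sum_eq_zero fun t _ => ?_
    rw [lintegral_smul_measure, lintegral_dirac' _ hm]
    cases ht : (t n).1
    · rw [costE_of_idle (by exact ht), smul_zero]
    · rw [Finset.prod_eq_zero (Finset.mem_univ n) (by simp [choiceProb, idleInstr, ht])]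
      simp
  rw [this, mul_zero]

/-- With i.i.d. states, those of slot `k + 1` are fresh draws from `p`, independent of the past. The
next prior variance and belief do not depend on them, so the second argument of `next` on the right
is a dummy, filled with the current states. -/
lemma lintegral_succ_decentralized (h : ∀ g, M.trans g = M.steady) {p : PMF M.State}
    (hp : M.IsSteady p) (δ : M.decentralized.Policy) (p₀ : PMF M.State) (k : ℕ)
    {F : (M.DecInstr × M.Action) × M.State → ℝ≥0∞} (hF : Measurable F) :
    ∫⁻ ω, F ((ω (k + 1)).2, (ω (k + 1)).1.2.2) ∂(δ.law p₀)
      = ∫⁻ ω, ∑ g, p g * ∫⁻ d, ∫⁻ x, F ((d, x), g) ∂(M.decAct (d, g))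
        ∂(δ.draw (k + 1) ((M.decentralized.next (ω k, (ω k).1.2.2)).1,
          (M.decentralized.next (ω k, (ω k).1.2.2)).2.1)) ∂(δ.law p₀) := by
  have hF' : Measurable fun z : M.decentralized.Slot => F (z.2, z.1.2.2) :=
    hF.comp (measurable_snd.prodMk (measurable_snd.comp (measurable_snd.comp measurable_fst)))
  refine (Scheme.lintegral_law_succ δ p₀ k hF').trans (lintegral_congr fun ω => ?_)
  rw [Scheme.lintegral_step δ k (ω k) hF']
  refine Finset.sum_congr rfl fun g _ => ?_
  simp only [h, ← hp g]
  congr 1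
  exact Scheme.lintegral_decide δ (k + 1) (M.decentralized.next (ω k, g))
    (f := fun w => F (w, g)) (hF.comp measurable_prodMk_right)

lemma lintegral_slotPair_decentralized (h : ∀ g, M.trans g = M.steady) {p : PMF M.State}
    (hp : M.IsSteady p) (δ : M.decentralized.Policy) (p₀ : PMF M.State) (k : ℕ)
    {f : M.Action × M.State → ℝ≥0∞} (hf : Measurable f) :
    ∫⁻ ω, f (Scheme.slotPair (ω (k + 1))) ∂(δ.law p₀)
      = ∫⁻ d, decMean p f d ∂((δ.law p₀).map fun ω => (ω (k + 1)).2.1) := by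
  have hd : Measurable fun ω : ℕ → M.decentralized.Slot => (ω (k + 1)).2.1 := by fun_prop
  have hm := measurable_decMean p hf
  rw [lintegral_map hm hd]
  -- The formula is used twice, for `f` and for the function `decMean p f` of the instruction alone;
  -- both reduce to the same integral.
  refine (lintegral_succ_decentralized h hp δ p₀ k
    (F := fun q => f (q.1.2, q.2)) (by fun_prop)).trans
    (.trans (lintegral_congr fun ω => ?_) (lintegral_succ_decentralized h hp δ p₀ k
    (F := fun q => decMean p f q.1.1) (by fun_prop)).symm)
  exact (lintegral_decMean p hf _).symm.trans (sum_lintegral_const p (decMean p f) _).symm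

theorem longRunSNR_le_slotMaxSNR_decentralized (h : ∀ g, M.trans g = M.steady) {p : PMF M.State}
    (hp : M.IsSteady p) (δ : M.decentralized.Policy) (p₀ : PMF M.State) (hδ : δ.Feasible p₀) :
    δ.longRunSNR p₀ ≤ M.decentralized.slotMaxSNR p := by
  refine Scheme.longRunSNR_le_slotMaxSNR δ p₀ p hδ _
    (Scheme.tendsto_const_mul_inv_atTop (ENNReal.ofReal M.snrBound) ENNReal.ofReal_ne_top)
    fun θ hθ => Eventually.of_forall fun T => ?_
  set w : ℝ≥0∞ := θ * ((T : ℝ≥0∞) + 1)⁻¹ with hw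
  have hθ1 : (θ : ℝ≥0∞) ≤ 1 := by exact_mod_cast hθ.le
  have hwT : w * T ≤ 1 := by
    rw [hw, mul_assoc]
    refine mul_le_one' hθ1 ?_
    rw [mul_comm, ← div_eq_mul_inv]
    exact ENNReal.div_le_of_le_mul (by rw [one_mul]; exact le_self_add)
  let lam : ℕ → Measure M.DecInstr := fun k => (δ.law p₀).map fun ω => (ω (k + 1)).2.1
  have hlam : ∀ k, IsProbabilityMeasure (lam k) := fun k =>
    Measure.isProbabilityMeasure_map
      (by fun_prop : Measurable fun ω : ℕ → M.decentralized.Slot => (ω (k + 1)).2.1).aemeasurable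
  -- Only the slots `1, …, T` are imitated, since the states of slot `0` need not be steady. The
  -- omitted slot only lowers the cost, and loses at most `snrBound / (T + 1)` of SNR. The missing
  -- mass goes to the idle instruction.
  let κ : Measure M.DecInstr :=
    w • ∑ k ∈ Finset.range T, lam k + (1 - w * T) • Measure.dirac M.idleInstr
  have hκ : IsProbabilityMeasure κ := ⟨by
    simp only [κ, Measure.add_apply, Measure.smul_apply, Measure.coe_finsetSum, Finset.sum_apply,
      measure_univ, smul_eq_mul, mul_one, Finset.sum_const, Finset.card_range, nsmul_eq_mul]
    exact add_tsub_cancel_of_le hwT⟩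
  let K : Kernel M.Belief M.DecInstr := Kernel.const _ κ
  have hK : IsMarkovKernel K := ⟨fun _ => hκ⟩
  have hslot : ∀ {f : M.Action × M.State → ℝ≥0∞}, Measurable f →
      Scheme.slotAvg M.decentralized p K f
        = w * ∑ k ∈ Finset.range T, ∫⁻ ω, f (Scheme.slotPair (ω (k + 1))) ∂(δ.law p₀)
          + (1 - w * T) * decMean p f M.idleInstr := fun {f} hf => by
    refine (@Scheme.slotAvg_eq M M.decentralized p K hK _ hf).trans
      ((lintegral_decMean p hf κ).symm.trans ?_)
    simp only [κ, lintegral_add_measure, lintegral_smul_measure, lintegral_finsetSum_measure,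
      lintegral_dirac' _ (measurable_decMean p hf), smul_eq_mul]
    simp only [lintegral_slotPair_decentralized h hp δ p₀ _ hf, lam]
  have havg : ∀ f : M.Action × M.State → ℝ≥0∞, θ * δ.avg p₀ f T
      = w * ∑ k ∈ Finset.range T, ∫⁻ ω, f (Scheme.slotPair (ω (k + 1))) ∂(δ.law p₀)
        + w * ∫⁻ ω, f (Scheme.slotPair (ω 0)) ∂(δ.law p₀) := fun f => by
    unfold Scheme.Policy.avg
    rw [Finset.sum_range_succ', ← mul_assoc, mul_add]
  refine ⟨K, hK, fun n => ?_, ?_⟩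
  · rw [hslot (measurable_costE n), havg, decMean_costE_idleInstr, mul_zero]
    gcongr
    exact zero_le
  · rw [hslot measurable_snrE, havg]
    refine add_le_add le_self_add ?_
    have h1 := Scheme.lintegral_snrE_le δ p₀ 0
    rw [mul_comm, hw]
    gcongr
    exact mul_le_of_le_one_left zero_le hθ1


/-! ### Convergence of the law of the accuracy states -/

namespace Scheme
variable {s : Scheme M}

/-- Probability that the accuracy-state vector is `g` in slot `k`. -/
noncomputable def Policy.stateProb (δ : s.Policy) (p₀ : PMF M.State) (k : ℕ) (g : M.State) :
    ℝ≥0∞ :=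
  δ.law p₀ {ω | (ω k).1.2.2 = g}

lemma measurableSet_state_eq (k : ℕ) (g : M.State) :
    MeasurableSet {ω : ℕ → s.Slot | (ω k).1.2.2 = g} :=
  (by fun_prop : Measurable fun ω : ℕ → s.Slot => (ω k).1.2.2) (measurableSet_singleton g)

/-- Law of the actions in slot `k` on the event that the accuracy-state vector is `g`. -/
noncomputable def Policy.actionLaw (δ : s.Policy) (p₀ : PMF M.State) (k : ℕ) (g : M.State) :
    Measure M.Action :=
  ((δ.law p₀).restrict {ω | (ω k).1.2.2 = g}).map fun ω => (ω k).2.2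

lemma actionLaw_univ (δ : s.Policy) (p₀ : PMF M.State) (k : ℕ) (g : M.State) :
    δ.actionLaw p₀ k g Set.univ = δ.stateProb p₀ k g := by
  unfold Policy.actionLaw Policy.stateProb
  rw [Measure.map_apply (by fun_prop) MeasurableSet.univ]
  simp

lemma lintegral_slotPair (δ : s.Policy) (p₀ : PMF M.State) (k : ℕ)
    {f : M.Action × M.State → ℝ≥0∞} (hf : Measurable f) :
    ∫⁻ ω, f (slotPair (ω k)) ∂(δ.law p₀) = ∑ g, ∫⁻ x, f (x, g) ∂(δ.actionLaw p₀ k g) := by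
  classical
  have hm : ∀ g, Measurable fun ω : ℕ → s.Slot => f ((ω k).2.2, g) := fun g => by fun_prop
  have h : ∀ ω : ℕ → s.Slot, f (slotPair (ω k))
      = ∑ g, {ω : ℕ → s.Slot | (ω k).1.2.2 = g}.indicator (fun ω => f ((ω k).2.2, g)) ω := by
    intro ω
    simp [slotPair, Set.indicator_apply]
  simp only [h]
  rw [lintegral_finsetSum _ fun g _ => (hm g).indicator (measurableSet_state_eq k g)]
  refine Finset.sum_congr rfl fun g _ => ?_
  rw [lintegral_indicator (measurableSet_state_eq k g)]
  unfold Policy.actionLaw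
  rw [lintegral_map (by fun_prop) (by fun_prop)]

lemma lintegral_state (δ : s.Policy) (p₀ : PMF M.State) (k : ℕ) (f : M.State → ℝ≥0∞) :
    ∫⁻ ω, f (ω k).1.2.2 ∂(δ.law p₀) = ∑ g, δ.stateProb p₀ k g * f g := by
  have hf : Measurable f := measurable_of_countable f
  refine (lintegral_slotPair δ p₀ k (f := fun q => f q.2) (by fun_prop)).trans
    (Finset.sum_congr rfl fun g _ => ?_)
  dsimp only
  rw [lintegral_const, actionLaw_univ, mul_comm]

open Classical in
lemma stateProb_eq_lintegral (δ : s.Policy) (p₀ : PMF M.State) (k : ℕ) (g : M.State) :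
    δ.stateProb p₀ k g = ∫⁻ ω, (if (ω k).1.2.2 = g then 1 else 0) ∂(δ.law p₀) := by
  rw [lintegral_state δ p₀ k fun g' => if g' = g then 1 else 0]
  simp

lemma stateProb_zero (δ : s.Policy) (p₀ : PMF M.State) (g : M.State) :
    δ.stateProb p₀ 0 g = p₀ g := by
  classical
  have hm : Measurable fun z : s.Slot => if z.1.2.2 = g then (1 : ℝ≥0∞) else 0 :=
    (measurable_of_countable fun g' : M.State => if g' = g then (1 : ℝ≥0∞) else 0).comp
      (by fun_prop : Measurable fun z : s.Slot => z.1.2.2)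
  rw [stateProb_eq_lintegral, lintegral_law_zero δ p₀ hm, lintegral_initial δ p₀ hm]
  change ∑ g', p₀ g' * ∫⁻ _, (if g' = g then 1 else 0) ∂(δ.decide 0 _) = p₀ g
  simp

/-- The accuracy states form an autonomous Markov chain, unaffected by the policy. -/
lemma stateProb_succ (δ : s.Policy) (p₀ : PMF M.State) (k : ℕ) (g' : M.State) :
    δ.stateProb p₀ (k + 1) g'
      = ∑ g, δ.stateProb p₀ k g * ∏ n, M.trans (g n) (g' n) := by
  classical
  have hm : Measurable fun z : s.Slot => if z.1.2.2 = g' then (1 : ℝ≥0∞) else 0 :=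
    (measurable_of_countable fun g : M.State => if g = g' then (1 : ℝ≥0∞) else 0).comp
      (by fun_prop : Measurable fun z : s.Slot => z.1.2.2)
  rw [stateProb_eq_lintegral, lintegral_law_succ δ p₀ k hm,
    ← lintegral_state δ p₀ k fun g => ∏ n, M.trans (g n) (g' n)]
  refine lintegral_congr fun ω => ?_
  rw [lintegral_step δ k (ω k) hm]
  have hn : ∀ g, (s.next (ω k, g)).2.2 = g := fun g => rfl
  simp [hn]

/-- Coordinatewise products of laws move independently. -/
lemma sum_prod_mul_trans (q : Fin M.N → PMF M.Γ) (g' : M.State) :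
    ∑ g : M.State, (∏ n, q n (g n)) * ∏ n, M.trans (g n) (g' n)
      = ∏ n, ((q n).bind M.trans) (g' n) := by
  simp only [← Finset.prod_mul_distrib, PMF.bind_apply, tsum_fintype]
  exact (Fintype.prod_sum fun n c => q n c * M.trans c (g' n)).symm

lemma stateProb_steady {p : PMF M.State} (hp : M.IsSteady p) (δ : s.Policy) (k : ℕ)
    (g : M.State) : δ.stateProb p k g = p g := by
  induction k generalizing g with
  | zero => exact stateProb_zero δ p g
  | succ k ih =>
    rw [stateProb_succ]
    simp only [ih]
    rw [Finset.sum_congr rfl fun g' _ => congrArg (· * _) (hp g'),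
      sum_prod_mul_trans (fun _ => M.steady), M.steady_invariant, hp]

/-- As `p₀` is arbitrary, the coordinates are independent only conditionally on the initial vector;
hence a mixture of product laws. -/
lemma stateProb_eq (δ : s.Policy) (p₀ : PMF M.State) (k : ℕ) (g' : M.State) :
    δ.stateProb p₀ k g' = ∑ g, p₀ g *
      ∏ n, ((fun q : PMF M.Γ => q.bind M.trans)^[k] (PMF.pure (g n))) (g' n) := by
  classical
  induction k generalizing g' with
  | zero =>
    rw [stateProb_zero, Finset.sum_eq_single g']
    · simp
    · intro g _ hg
      obtain ⟨n, hn⟩ := Function.ne_iff.1 hg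
      rw [Finset.prod_eq_zero (Finset.mem_univ n), mul_zero]
      simp [PMF.pure_apply, Ne.symm hn]
    · simp
  | succ k ih =>
    rw [stateProb_succ]
    simp only [ih, Function.iterate_succ_apply', ← sum_prod_mul_trans, Finset.sum_mul,
      Finset.mul_sum, mul_assoc]
    exact Finset.sum_comm

lemma tendsto_stateProb {p p₀ : PMF M.State} (hp : M.IsSteady p) (h : M.Ergodic ∨ p₀ = p)
    (δ : s.Policy) (g : M.State) :
    Tendsto (fun k => δ.stateProb p₀ k g) atTop (𝓝 (p g)) := by
  rcases h with h | rfl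
  · have key : Tendsto (fun k => δ.stateProb p₀ k g) atTop (𝓝 (∑ g₀, p₀ g₀ * p g)) := by
      simp only [stateProb_eq]
      refine tendsto_finsetSum _ fun g₀ _ => ?_
      refine ENNReal.Tendsto.const_mul ?_ (Or.inr (p₀.apply_ne_top g₀))
      rw [hp g]
      exact ENNReal.tendsto_finsetProd_of_ne_top _ (fun n _ => h (g₀ n) (g n))
        fun n _ => M.steady.apply_ne_top _
    rwa [← Finset.sum_mul, sum_pmf, one_mul] at key
  · simp only [stateProb_steady hp]
    exact tendsto_const_nhds

/-- Averaged law of the accuracy states. -/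
noncomputable def Policy.avgStateProb (δ : s.Policy) (p₀ : PMF M.State) (g : M.State) (T : ℕ) :
    ℝ≥0∞ :=
  ((T : ℝ≥0∞) + 1)⁻¹ * ∑ k ∈ Finset.range (T + 1), δ.stateProb p₀ k g

lemma tendsto_avgStateProb {p p₀ : PMF M.State} (hp : M.IsSteady p) (h : M.Ergodic ∨ p₀ = p)
    (δ : s.Policy) (g : M.State) : Tendsto (δ.avgStateProb p₀ g) atTop (𝓝 (p g)) := by
  have hfin : ∀ k, δ.stateProb p₀ k g ≠ ⊤ := fun k => measure_ne_top _ _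
  have h1 : Tendsto (fun k => (δ.stateProb p₀ k g).toReal) atTop (𝓝 (p g).toReal) :=
    (ENNReal.tendsto_toReal (p.apply_ne_top g)).comp (tendsto_stateProb hp h δ g)
  -- Cesàro averaging, shifted by one because the average runs over `T + 1` slots.
  have h2 := ENNReal.tendsto_ofReal ((tendsto_add_atTop_iff_nat 1).2 h1.cesaro)
  rw [ENNReal.ofReal_toReal (p.apply_ne_top g)] at h2
  refine h2.congr fun T => ?_
  unfold Policy.avgStateProb
  rw [ENNReal.ofReal_mul (by positivity), ENNReal.ofReal_sum_of_nonneg fun _ _ =>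
    ENNReal.toReal_nonneg, ENNReal.ofReal_inv_of_pos (by positivity), ENNReal.ofReal_natCast]
  simp only [ENNReal.ofReal_toReal (hfin _), Nat.cast_add, Nat.cast_one]

end Scheme

/-! ### Time sharing in the coordinated scheme -/

/-- The coordinated belief is the indicator of the true state. It embeds a finite set, so it has a
measurable left inverse defined on all beliefs; policies, which see only the belief, can thus act on
the state. -/
lemma exists_measurable_decode (M : Model) :
    ∃ dec : M.Belief → M.State, Measurable dec ∧
      ∀ (β : M.Belief) (g : M.State), dec (M.coordinated.belief β g) = g := by
  classical
  let e : M.State → M.Belief := fun g g' => if g' = g then 1 else 0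
  have he : MeasurableEmbedding e := by
    refine ⟨fun g g' h => ?_, measurable_of_countable e, fun t _ => ?_⟩
    · by_contra hne
      have := congrFun h g
      simp [e, hne] at this
    · exact ((Set.toFinite t).image e).measurableSet
  obtain ⟨dec, hdec, hd⟩ := he.exists_measurable_extend measurable_id
    fun _ => ⟨fun _ => ⟨1, M.one_mem⟩⟩
  refine ⟨dec, hdec, fun β g => ?_⟩
  have := congrFun hd g
  simp only [Function.comp_apply, id_eq] at this
  refine Eq.trans (congrArg dec (funext fun g' => ?_)) this
  by_cases h : g' = g <;> simp [coordinated, e, h]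

/-- Any law of the actions given the accuracy states can be used in the coordinated scheme. -/
lemma exists_kernel_coordinated (p : PMF M.State) (κ : M.State → Measure M.Action)
    (hκ : ∀ g, IsProbabilityMeasure (κ g)) :
    ∃ K : Kernel M.Belief M.coordinated.Instr, IsMarkovKernel K ∧
      ∀ f : M.Action × M.State → ℝ≥0∞, Measurable f →
        M.coordinated.slotAvg p K f = ∑ g, p g * ∫⁻ x, f (x, g) ∂(κ g) := by
  obtain ⟨dec, hdec, hd⟩ := exists_measurable_decode M
  let K₀ : Kernel M.State M.Action := Kernel.ofFunOfCountable κ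
  have hK₀ : IsMarkovKernel K₀ := ⟨hκ⟩
  let K : Kernel M.Belief M.Action := K₀.comap dec hdec
  have hK : IsMarkovKernel K := Kernel.IsMarkovKernel.comap _ hdec
  refine ⟨K, hK, fun f hf => ?_⟩
  refine (@Scheme.slotAvg_eq M M.coordinated p K hK _ hf).trans
    (Finset.sum_congr rfl fun g _ => ?_)
  congr 1
  have h1 : K (M.coordinated.belief (fun g' => (p g').toReal) g) = κ g := by
    change κ (dec _) = κ g
    rw [hd]
  refine (congrArg (fun μ : Measure M.Action =>
    ∫⁻ d, ∫⁻ x, f (x, g) ∂(M.coordinated.act (d, g)) ∂μ) h1).trans (lintegral_congr fun d => ?_)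
  exact Kernel.lintegral_deterministic' (f := fun x => f (x, g)) measurable_fst (by fun_prop)

theorem longRunSNR_le_slotMaxSNR_coordinated {p p₀ : PMF M.State} (hp : M.IsSteady p)
    (h : M.Ergodic ∨ p₀ = p) (δ : M.coordinated.Policy) (hδ : δ.Feasible p₀) :
    δ.longRunSNR p₀ ≤ M.coordinated.slotMaxSNR p := by
  classical
  have hlim := Scheme.tendsto_avgStateProb hp h δ
  refine Scheme.longRunSNR_le_slotMaxSNR δ p₀ p hδ
    -- States that are null in steady state never occur in the single slot. The SNR collected in
    -- them is the error term; it vanishes because their averaged probability does.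
    (fun T => ∑ g, if p g = 0 then ENNReal.ofReal M.snrBound * δ.avgStateProb p₀ g T else 0) ?_
    fun θ hθ => ?_
  · have : Tendsto (fun T => ∑ g, if p g = 0 then
        ENNReal.ofReal M.snrBound * δ.avgStateProb p₀ g T else 0) atTop
        (𝓝 (∑ _g : M.State, (0 : ℝ≥0∞))) := by
      refine tendsto_finsetSum _ fun g _ => ?_
      split_ifs with hg
      · have := ENNReal.Tendsto.const_mul (a := ENNReal.ofReal M.snrBound) (hlim g)
          (Or.inr ENNReal.ofReal_ne_top)
        rwa [hg, mul_zero] at this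
      · exact tendsto_const_nhds
    simpa using this
  have hθ1 : (θ : ℝ≥0∞) < 1 := by exact_mod_cast hθ
  -- Here the slack `θ < 1` absorbs the distance of the averaged state law from `p`.
  have hev : ∀ᶠ T in atTop, ∀ g, p g ≠ 0 → θ * δ.avgStateProb p₀ g T ≤ p g := by
    rw [eventually_all]
    intro g
    by_cases hg : p g = 0
    · simp [hg]
    have hlt : θ * p g < p g := by
      have := ENNReal.mul_lt_mul_left hg (p.apply_ne_top g) hθ1
      rwa [one_mul] at this
    filter_upwards [(ENNReal.Tendsto.const_mul (a := (θ : ℝ≥0∞)) (hlim g)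
      (Or.inr ENNReal.coe_ne_top)).eventually_lt_const hlt] with T hT _
    exact hT.le
  filter_upwards [hev] with T hT
  set w : ℝ≥0∞ := θ * ((T : ℝ≥0∞) + 1)⁻¹ with hw
  -- Given `g`, this is `θ` times the time-averaged action law on the event that the state is `g`,
  -- divided by `p g`. By `hT` its mass is at most `1`; idling, which is free, fills the rest.
  let κ : M.State → Measure M.Action := fun g =>
    if p g = 0 then Measure.dirac M.idleAction
    else (w * (p g)⁻¹) • ∑ k ∈ Finset.range (T + 1), δ.actionLaw p₀ k g
      + (1 - (p g)⁻¹ * (θ * δ.avgStateProb p₀ g T)) • Measure.dirac M.idleAction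
  have hκ : ∀ g, IsProbabilityMeasure (κ g) := fun g => by
    by_cases hg : p g = 0
    · simp only [κ, if_pos hg]
      infer_instance
    refine ⟨?_⟩
    simp only [κ, if_neg hg, Measure.add_apply, Measure.smul_apply, Measure.coe_finsetSum,
      Finset.sum_apply, measure_univ, smul_eq_mul, mul_one, Scheme.actionLaw_univ]
    have e : w * (p g)⁻¹ * ∑ k ∈ Finset.range (T + 1), δ.stateProb p₀ k g
        = (p g)⁻¹ * (θ * δ.avgStateProb p₀ g T) := by
      rw [hw, Scheme.Policy.avgStateProb]
      ring
    rw [e]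
    refine add_tsub_cancel_of_le ?_
    rw [mul_comm, ← div_eq_mul_inv]
    exact ENNReal.div_le_of_le_mul (by rw [one_mul]; exact hT g hg)
  obtain ⟨K, hK, hslot⟩ := exists_kernel_coordinated p κ hκ
  let a : (M.Action × M.State → ℝ≥0∞) → M.State → ℝ≥0∞ := fun f g =>
    w * ∑ k ∈ Finset.range (T + 1), ∫⁻ x, f (x, g) ∂(δ.actionLaw p₀ k g)
  have havg : ∀ f : M.Action × M.State → ℝ≥0∞, Measurable f →
      θ * δ.avg p₀ f T = ∑ g, a f g := fun f hf => by
    unfold Scheme.Policy.avg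
    simp only [Scheme.lintegral_slotPair δ p₀ _ hf, a]
    rw [← mul_assoc, Finset.sum_comm, Finset.mul_sum]
  have hterm : ∀ f : M.Action × M.State → ℝ≥0∞, Measurable f → ∀ g, p g ≠ 0 →
      p g * ∫⁻ x, f (x, g) ∂(κ g) = a f g
        + p g * ((1 - (p g)⁻¹ * (θ * δ.avgStateProb p₀ g T)) * f (M.idleAction, g)) := by
    intro f hf g hg
    have hf' : Measurable fun x => f (x, g) := by fun_prop
    simp only [κ, if_neg hg, lintegral_add_measure, lintegral_smul_measure,
      lintegral_finsetSum_measure, lintegral_dirac' _ hf', smul_eq_mul]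
    rw [mul_add]
    congr 1
    rw [mul_comm w, mul_assoc, ← mul_assoc (p g),
      ENNReal.mul_inv_cancel hg (p.apply_ne_top g), one_mul]
  refine ⟨K, hK, fun n => ?_, ?_⟩
  · rw [hslot _ (measurable_costE n), havg _ (measurable_costE n)]
    refine Finset.sum_le_sum fun g _ => ?_
    by_cases hg : p g = 0
    · simp [hg]
    · rw [hterm _ (measurable_costE n) g hg, costE_of_idle rfl]
      simp
  · rw [hslot _ measurable_snrE, havg _ measurable_snrE, ← Finset.sum_add_distrib]
    refine Finset.sum_le_sum fun g _ => ?_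
    by_cases hg : p g = 0
    · rw [if_pos hg, hg, zero_mul, zero_add]
      calc a snrE g ≤ w * ∑ k ∈ Finset.range (T + 1),
            ENNReal.ofReal M.snrBound * δ.stateProb p₀ k g := by
            simp only [a]
            gcongr with k
            refine (lintegral_mono fun x => snrE_le _).trans ?_
            rw [lintegral_const, Scheme.actionLaw_univ]
        _ = θ * (ENNReal.ofReal M.snrBound * δ.avgStateProb p₀ g T) := by
            rw [hw, Scheme.Policy.avgStateProb, ← Finset.mul_sum]
            ring
        _ ≤ _ := mul_le_of_le_one_left zero_le hθ1.le
    · rw [if_neg hg, add_zero, hterm _ measurable_snrE g hg]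
      exact le_self_add

end Model
end SensorNet

theorem mainTheorem3 (M : SensorNet.Model) (p₀ p : PMF M.State) (hp : M.IsSteady p)
    (hsteady : M.Ergodic ∨ p₀ = p) :
    (∀ δ : M.coordinated.Policy, δ.Feasible p₀ →
      SensorNet.nuStar M.α (M.coordinated.maxSNR p₀) ≤ δ.longRunMSE p₀ ∧
      SensorNet.nuStar M.α (M.coordinated.slotMaxSNR p) ≤ δ.longRunMSE p₀) ∧
    (∀ δ : M.decentralized.Policy, δ.Feasible p₀ →
      SensorNet.nuStar M.α (M.decentralized.maxSNR p₀) ≤ δ.longRunMSE p₀ ∧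
      ((∀ g, M.trans g = M.steady) →
        SensorNet.nuStar M.α (M.decentralized.slotMaxSNR p) ≤ δ.longRunMSE p₀)) :=
  ⟨fun δ hδ => ⟨SensorNet.Model.Scheme.nuStar_le_longRunMSE δ p₀
      (SensorNet.Model.Scheme.longRunSNR_le_maxSNR δ p₀ hδ),
    SensorNet.Model.Scheme.nuStar_le_longRunMSE δ p₀
      (SensorNet.Model.longRunSNR_le_slotMaxSNR_coordinated hp hsteady δ hδ)⟩,
  fun δ hδ => ⟨SensorNet.Model.Scheme.nuStar_le_longRunMSE δ p₀
      (SensorNet.Model.Scheme.longRunSNR_le_maxSNR δ p₀ hδ),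
    fun h => SensorNet.Model.Scheme.nuStar_le_longRunMSE δ p₀
      (SensorNet.Model.longRunSNR_le_slotMaxSNR_decentralized h hp δ p₀ hδ)⟩⟩
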